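/- **Setting.** Let $X\subset\mathbb{R}^k$ be a compact smooth embedded submanifold without boundary, of dimension $s$, with normal space $N_x$ at $x\in X$. Write $d(x,A)=\inf_{a\in A}d(x,a)$, with $d(x,\emptyset)=\infty$, and for $x\in\mathbb{R}^k$ let $\Pi(x)=\{y\in X: d(x,y)=d(x,X)\}$. - The medial axis $M$ is the closure of $\{m\in\mathbb{R}^k:|\Pi(m)|\ge 2\}$, and $\mathrm{lfs}(x)=d(x,M)$ is the local feature size. - For $x\in\mathbb{R}^k\setminus X$ let $c(x)$ be the centre of the minimal enclosing ball of $\Pi(x)$ and $\nabla(x)=\frac{x-c(x)}{d(x,X)}$. Let $C=\{x\in\mathbb{R}^k\setminus X:\nabla(x)=0\}$ be the set of critical points of the distance function to $X$; $\mathrm{lwfs}(x)=d(x,C)$ is the weak local feature size. - Angles between a line and a linear subspace lie in $[0,\pi/2]$ and are measured between the line and its orthogonal projection to the subspace; the angle between two linear subspaces of the same dimension is their largest principal angle (and it is $\pi/2$ if the dimensions differ). - Let $\varepsilon>0$ and $\nu_\varepsilon\ge 0$. Let $P\subset X$ be a finite sample that is $\varepsilon$-dense with respect to $\mathrm{lfs}$,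 that is, $d(x,P)\le\varepsilon\,\mathrm{lfs}(x)$ for all $x\in X$. Let every $p\in P$ carry a linear subspace $V_p\subseteq\mathbb{R}^k$ (an estimated normal space) with $\angle(V_p,N_p)\le\nu_\varepsilon$. - For $0<\beta<\pi/2$ put $c_\beta=\frac13\tan\frac\beta2$. A pair $(p,q)$ of distinct points of $P$ is $\beta$-good if $\max\{\angle(V_p,pq),\angle(V_q,pq)\}\le\frac\pi2-\beta$ and the open ball with centre $\frac{p+q}{2}$ and radius $c_\beta\, d(p,q)$ contains no point of $P$. The $\beta$-lean set $L_\beta$ is the set of midpoints $\frac{p+q}{2}$ of $\beta$-good pairs $(p,q)$, and $\mathrm{lnfs}(x)=d(x,L_\beta)$ is the $\beta$-lean feature size. **Theorem 1.** Let $\theta,\beta>0$ satisfy $\frac\pi4\ge\theta\ge\beta+\frac32\sqrt\varepsilon+\nu_\varepsilon$ and $\varepsilon\le\frac18\sin^2\theta$. Put $$c_1=1+\cos\theta+\varepsilon,\qquad c_0=\sin(\beta-\nu_\varepsilon),\qquad c_2=\frac{2c_0c_\beta}{1+c_0+2c_0c_\beta}.$$ Then 1. $\mathrm{lnfs}(x)\le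 c_1\cdot\mathrm{lwfs}(x)$ for every $x\in X$; 2. $\mathrm{lnfs}(p)\ge c_2\cdot\mathrm{lfs}(p)$ for every $p\in P$. Here $c_1>0$ and $c_\beta>0$; moreover $c_0>0$ and $c_2>0$ whenever $\nu_\varepsilon<\beta$. (If $\nu_\varepsilon\ge\beta$, then $c_2\le 0$ and part 2 is trivial.) -/

import Mathlib

open scoped ENNReal ContDiff Topology

noncomputable section

namespace LeanFeature

/-- The ambient Euclidean space `ℝ^k`. -/
abbrev E (k : ℕ) : Type := EuclideanSpace ℝ (Fin k)

variable {k : ℕ}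

/-! ### Smooth submanifolds of Euclidean space -/

/-- `X` is a smooth (`C^∞`) embedded submanifold of `ℝ^k`, without boundary and of dimension `s`:
around each of its points some smooth diffeomorphism between open sets of `ℝ^k` carries `X` to
an `s`-dimensional linear subspace (a slice chart). -/
def IsSmoothSubmanifold (s : ℕ) (X : Set (E k)) : Prop :=
  ∀ x ∈ X, ∃ (Φ : OpenPartialHomeomorph (E k) (E k)) (W : Submodule ℝ (E k)),
    x ∈ Φ.source ∧
    ContDiffOn ℝ ∞ Φ Φ.source ∧
    ContDiffOn ℝ ∞ Φ.symm Φ.target ∧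
    Module.finrank ℝ W = s ∧
    ∀ y ∈ Φ.source, (y ∈ X ↔ Φ y ∈ W)

/-- The velocities at `x` of curves that run in `X` and pass through `x`. -/
def tangentVectors (X : Set (E k)) (x : E k) : Set (E k) :=
  {v | ∃ γ : ℝ → E k, γ 0 = x ∧ (∀ᶠ t in 𝓝 (0 : ℝ), γ t ∈ X) ∧ HasDerivAt γ v 0}

/-- The normal space of `X` at `x`: the orthogonal complement of the tangent space. -/
def normalSpace (X : Set (E k)) (x : E k) : Submodule ℝ (E k) :=
  (Submodule.span ℝ (tangentVectors X x))ᗮ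

/-! ### Closest points, medial axis, critical points, feature sizes

Distances to sets are `Metric.infEDist`, so that the distance to the empty set is `∞`. -/

/-- `Π(x)`: the points of `X` that are closest to `x`. -/
def closestPoints (X : Set (E k)) (x : E k) : Set (E k) :=
  {y | y ∈ X ∧ dist x y = Metric.infDist x X}

/-- The medial axis of `X`: the closure of the set of points with at least two closest points
in `X`. -/
def medialAxis (X : Set (E k)) : Set (E k) :=
  closure {m | (closestPoints X m).Nontrivial}

/-- The local feature size `lfs(x) = d(x, M)`, where `M` is the medial axis of `X`. -/
def lfs (X : Set (E k)) (x : E k) : ℝ≥0∞ :=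
  Metric.infEDist x (medialAxis X)

/-- The closed ball with centre `c` and radius `r` is a minimal enclosing ball of `S`. -/
def IsMinEnclosingBall (S : Set (E k)) (c : E k) (r : ℝ) : Prop :=
  S ⊆ Metric.closedBall c r ∧ ∀ (c' : E k) (r' : ℝ), S ⊆ Metric.closedBall c' r' → r ≤ r'

/-- `g` is the gradient vector `(x - c(x)) / d(x, X)` of the distance function to `X` at `x`,
where `c(x)` is the centre of the minimal enclosing ball of `Π(x)`. -/
def IsGradient (X : Set (E k)) (x g : E k) : Prop :=
  ∃ (c : E k) (r : ℝ), IsMinEnclosingBall (closestPoints X x) c r ∧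
    g = (Metric.infDist x X)⁻¹ • (x - c)

/-- The critical points of the distance function to `X`: the points off `X` where the gradient
vector vanishes. -/
def criticalPoints (X : Set (E k)) : Set (E k) :=
  {x | x ∉ X ∧ IsGradient X x 0}

/-- The weak local feature size `lwfs(x) = d(x, C)`, where `C` is the set of critical points. -/
def lwfs (X : Set (E k)) (x : E k) : ℝ≥0∞ :=
  Metric.infEDist x (criticalPoints X)

/-- `P` is `c`-dense in `X` with respect to `φ`. -/
def IsDenseWrt (c : ℝ) (φ : E k → ℝ≥0∞) (X : Set (E k)) (P : Finset (E k)) : Prop :=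
  ∀ x ∈ X, Metric.infEDist x (P : Set (E k)) ≤ ENNReal.ofReal c * φ x

/-! ### Angles with subspaces -/

/-- The angle in `[0, π/2]` between the line spanned by `v` and the subspace `U`, that is, the
angle between `v` and its orthogonal projection to `U` (it is `π/2` if that projection is `0`). -/
def lineAngle (U : Submodule ℝ (E k)) (v : E k) : ℝ :=
  InnerProductGeometry.angle v (U.starProjection v)

/-- The largest angle that a nonzero vector of `U` makes with `V` (`0` if `U` is zero). -/
def maxLineAngle (U V : Submodule ℝ (E k)) : ℝ :=
  sSup {a | ∃ u ∈ U, u ≠ 0 ∧ a = lineAngle V u}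

/-- The angle between two subspaces. If they have the same dimension, the two terms agree, and
are the largest principal angle; if they have different dimensions, the angle is `π/2`. -/
def subspaceAngle (U V : Submodule ℝ (E k)) : ℝ :=
  max (maxLineAngle U V) (maxLineAngle V U)

/-! ### Good pairs, the lean set, the lean feature size -/

/-- The constant `c_β = (1/3) tan (β/2)`. -/
def cBeta (β : ℝ) : ℝ := (1 / 3) * Real.tan (β / 2)

/-- The pair `(p, q)` of points of `P` is `β`-good with respect to the estimated normal spaces
`V`. Balls are open. -/
structure IsGoodPair (β : ℝ) (P : Finset (E k)) (V : E k → Submodule ℝ (E k)) (p q : E k) :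
    Prop where
  left_mem : p ∈ P
  right_mem : q ∈ P
  ne : p ≠ q
  angle_le : max (lineAngle (V p) (q - p)) (lineAngle (V q) (q - p)) ≤ Real.pi / 2 - β
  empty_ball : ∀ x ∈ P, x ∉ Metric.ball (midpoint ℝ p q) (cBeta β * dist p q)

/-- The `β`-lean set: the midpoints of the `β`-good pairs. -/
def leanSet (β : ℝ) (P : Finset (E k)) (V : E k → Submodule ℝ (E k)) : Set (E k) :=
  {z | ∃ p q, IsGoodPair β P V p q ∧ z = midpoint ℝ p q}

/-- The `β`-lean feature size `lnfs(x) = d(x, L_β)`, where `L_β` is the `β`-lean set. -/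
def lnfs (β : ℝ) (P : Finset (E k)) (V : E k → Submodule ℝ (E k)) (x : E k) : ℝ≥0∞ :=
  Metric.infEDist x (leanSet β P V)

/-- The constant `c₁ = 1 + cos θ + ε`. -/
def c₁ (θ ε : ℝ) : ℝ := 1 + Real.cos θ + ε

/-- The constant `c₀ = sin (β - ν)`. -/
def c₀ (β ν : ℝ) : ℝ := Real.sin (β - ν)

/-- The constant `c₂ = 2 c₀ c_β / (1 + c₀ + 2 c₀ c_β)`. -/
def c₂ (β ν : ℝ) : ℝ :=
  2 * c₀ β ν * cBeta β / (1 + c₀ β ν + 2 * c₀ β ν * cBeta β)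

end LeanFeature

end

namespace LeanFeature

open scoped RealInnerProductSpace

variable {k : ℕ}

/-! Upper bound. At a critical point `m` with `R = d(m, X)`, the set `Π(m)` contains `y, z` seen
from `m` under an angle of at least `π/2`; otherwise the enclosing ball could be shrunk. The
triangle `y m z` is isosceles, so the chord `yz` makes an angle of at most `π/4` with `m - y`, which
is normal to `X` at `y`. Density gives sample points `p, q` within `ε R` of `y, z`. The direction
changes from `yz` to `pq`, and the normal space from `y` to `p`, by angles of order `ε`, absorbed by
`3/2 * √ε`; passing to `V p` costs another `ν`. Hence `(p, q)` satisfies the angle condition. Its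
midpoint is within `(√2/2 + ε) R` of `m`, while no sample point is nearer to `m` than `R`, so the
small ball is empty. Thus `exists_mem_leanSet` places a lean point near `m`; the triangle inequality
and `R ≤ d(x, m)` finish.

Lower bound. The half-lengths of good pairs are bounded below by local feature size: a chord far
from tangential has a large normal component, but normal components are at most quadratic in the
chord length (`mul_sin_le_dist`). The empty ball keeps every sample point away from the midpoint in
proportion to the length.

Both halves rest on `inner_le_of_lfs`: tangent balls of radius at most `lfs` have no point of `X`
inside. A small tangent ball comes from smoothness; it grows because closest points persist along
normal rays away from the medial axis (`closestPoints_ray`). The variation of normal spaces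
(`inner_normal_tangent_le`) also needs points of `X` in every tangent direction at a controlled
scale, which `tangentCover` provides. -/

/-! ### Distance to `X` along normal rays -/

lemma closestPoints_nonempty {X : Set (E k)} (hX : IsCompact X) (hne : X.Nonempty) (x : E k) :
    (closestPoints X x).Nonempty := by
  obtain ⟨y, hy, h⟩ := hX.exists_infDist_eq_dist hne x
  exact ⟨y, hy, h.symm⟩

/-- At a point off `X` with a unique closest point, the distance to `X` grows with slope one
in the direction away from the closest point. -/
lemma exists_slope {X : Set (E k)} (hX : IsCompact X) {x q : E k} (hx : 0 < Metric.infDist x X)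
    (hq : q ∈ closestPoints X x) (hu : (closestPoints X x).Subsingleton) {η : ℝ} (hη : η < 1) :
    ∃ δ > 0, ∀ s, 0 ≤ s → s ≤ δ →
      Metric.infDist x X + η * s
        ≤ Metric.infDist (x + s • ((Metric.infDist x X)⁻¹ • (x - q))) X := by
  set h := Metric.infDist x X with hh
  set u : E k := h⁻¹ • (x - q) with hudef
  have hqX : q ∈ X := hq.1
  have hxq : ‖x - q‖ = h := by rw [← dist_eq_norm]; exact hq.2
  have hune : ‖u‖ = 1 := by
    rw [hudef, norm_smul, hxq, norm_inv, Real.norm_of_nonneg hx.le, inv_mul_cancel₀ hx.ne']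
  have hne : X.Nonempty := ⟨q, hqX⟩
  -- `K` collects the points of `X` seen from `x` well away from the direction of `q`. It is compact
  -- and omits the only closest point, so it lies beyond `h + 2 * δ` and stays irrelevant for small
  -- moves. From every other point of `X` the move recedes at rate at least `η`.
  set K : Set (E k) := X ∩ {z | ⟪u, x - z⟫ ≤ η * ‖x - z‖} with hK
  have hKc : IsCompact K := by
    apply hX.inter_right
    exact isClosed_le (by fun_prop) (by fun_prop)
  have hqK : q ∉ K := by
    rintro ⟨-, h2⟩
    simp only [Set.mem_ofPred_eq] at h2
    rw [hudef, real_inner_smul_left, real_inner_self_eq_norm_sq, hxq, pow_two, ← mul_assoc,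
      inv_mul_cancel₀ hx.ne', one_mul] at h2
    nlinarith
  obtain ⟨δ, hδ, hKδ⟩ : ∃ δ > 0, ∀ z ∈ K, h + 2 * δ ≤ dist x z := by
    rcases K.eq_empty_or_nonempty with he | hKne
    · exact ⟨1, one_pos, by simp [he]⟩
    · obtain ⟨z, hz, hzmin⟩ := hKc.exists_infDist_eq_dist hKne x
      have h1 : h ≤ dist x z := Metric.infDist_le_dist_of_mem hz.1
      have h2 : h ≠ dist x z := by
        intro h3
        have : z = q := hu ⟨hz.1, h3.symm⟩ hq
        exact hqK (this ▸ hz)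
      have h3 : h < dist x z := lt_of_le_of_ne h1 h2
      refine ⟨(dist x z - h) / 2, by linarith, fun w hw => ?_⟩
      have := Metric.infDist_le_dist_of_mem (x := x) hw
      rw [hzmin] at this
      linarith
  refine ⟨δ, hδ, fun s hs0 hsδ => ?_⟩
  rw [Metric.le_infDist hne]
  intro z hz
  by_cases hzK : z ∈ K
  · have h1 := hKδ z hzK
    have h2 : dist x z ≤ dist x (x + s • u) + dist (x + s • u) z := dist_triangle _ _ _
    have h3 : dist x (x + s • u) = s := by
      rw [dist_eq_norm, sub_add_cancel_left, norm_neg, norm_smul, hune,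
        Real.norm_of_nonneg hs0, mul_one]
    nlinarith
  · have h1 : η * ‖x - z‖ < ⟪u, x - z⟫ := by
      by_contra hcon
      exact hzK ⟨hz, not_lt.mp hcon⟩
    have hxz : h ≤ ‖x - z‖ := by
      rw [← dist_eq_norm]; exact Metric.infDist_le_dist_of_mem hz
    have h2 : ⟪x + s • u - z, x - z⟫ ≤ ‖x + s • u - z‖ * ‖x - z‖ := real_inner_le_norm _ _
    have h3 : ⟪x + s • u - z, x - z⟫ = ‖x - z‖ ^ 2 + s * ⟪u, x - z⟫ := by
      rw [show x + s • u - z = (x - z) + s • u by abel, inner_add_left, real_inner_smul_left,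
        real_inner_self_eq_norm_sq]
    rw [dist_eq_norm]
    have h4 : (‖x - z‖ + η * s) * ‖x - z‖ ≤ ‖x + s • u - z‖ * ‖x - z‖ := by
      nlinarith [mul_le_mul_of_nonneg_left h1.le hs0]
    have h5 := le_of_mul_le_mul_right h4 (lt_of_lt_of_le hx hxz)
    linarith

/-- If all points near `x` have a unique closest point, the distance to `X` increases by the full
radius within a closed ball around `x`. -/
lemma exists_infDist_add_le {X : Set (E k)} (hX : IsCompact X) (hne : X.Nonempty) {x : E k}
    (hx : 0 < Metric.infDist x X) {t : ℝ} (ht : 0 ≤ t)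
    (hu : ∀ z ∈ Metric.closedBall x t, (closestPoints X z).Subsingleton) {η : ℝ} (hη : η < 1)
    (hη0 : 0 < η) :
    ∃ z ∈ Metric.closedBall x t, Metric.infDist x X + η * t ≤ Metric.infDist z X := by
  -- On the compact set of points reached with average slope at least `η`, the distance to `X` has a
  -- maximizer. If it were interior to the ball, `exists_slope` would produce a better point of the
  -- set.
  set A : Set (E k) := Metric.closedBall x t ∩
    {z | Metric.infDist x X + η * dist z x ≤ Metric.infDist z X} with hA
  have hAc : IsCompact A := by
    apply (isCompact_closedBall x t).inter_right
    refine isClosed_le (by fun_prop) (Metric.continuous_infDist_pt X)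
  have hAne : A.Nonempty := ⟨x, by simp [ht], by simp⟩
  obtain ⟨z, hzA, hzmax⟩ := hAc.exists_isMaxOn hAne (Metric.continuous_infDist_pt X).continuousOn
  refine ⟨z, hzA.1, ?_⟩
  have hz2 : Metric.infDist x X + η * dist z x ≤ Metric.infDist z X := hzA.2
  have hz1 : dist z x ≤ t := hzA.1
  rcases hz1.eq_or_lt with heq | hlt
  · rwa [heq] at hz2
  · exfalso
    have hzpos : 0 < Metric.infDist z X := by nlinarith [dist_nonneg (x := z) (y := x)]
    obtain ⟨q, hq⟩ := closestPoints_nonempty hX hne z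
    obtain ⟨δ, hδ, hslope⟩ := exists_slope hX hzpos hq (hu z hzA.1) hη
    set s := min δ (t - dist z x) with hs
    have hs0 : 0 < s := lt_min hδ (by linarith)
    have h1 := hslope s hs0.le (min_le_left _ _)
    set w := z + s • ((Metric.infDist z X)⁻¹ • (z - q)) with hw
    have hwz : dist w z = s := by
      rw [dist_eq_norm, hw, add_sub_cancel_left, norm_smul, norm_smul, ← dist_eq_norm, hq.2,
        norm_inv, Real.norm_of_nonneg hzpos.le, inv_mul_cancel₀ hzpos.ne', mul_one,
        Real.norm_of_nonneg hs0.le]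
    have h2 : dist w x ≤ dist w z + dist z x := dist_triangle _ _ _
    have hst : s ≤ t - dist z x := min_le_right _ _
    have hwA : w ∈ A := by
      refine ⟨?_, ?_⟩
      · rw [Metric.mem_closedBall]; linarith
      · simp only [Set.mem_ofPred_eq]; nlinarith
    have h3 : Metric.infDist w X ≤ Metric.infDist z X := hzmax hwA
    nlinarith

/-- A closest point remains closest along the ray that leaves it, as long as closest points are
unique nearby. -/
lemma closestPoints_ray {X : Set (E k)} (hX : IsCompact X) {x q : E k}
    (hx : 0 < Metric.infDist x X) (hq : q ∈ closestPoints X x) {t : ℝ} (ht : 0 ≤ t)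
    (hu : ∀ z ∈ Metric.closedBall x t, (closestPoints X z).Subsingleton) :
    ∀ z ∈ X, Metric.infDist x X + t ≤ dist (x + t • ((Metric.infDist x X)⁻¹ • (x - q))) z := by
  have hne : X.Nonempty := ⟨q, hq.1⟩
  set h := Metric.infDist x X with hh
  obtain ⟨z, hz, hzmax⟩ := (isCompact_closedBall x t).exists_isMaxOn ⟨x, by simp [ht]⟩
    (Metric.continuous_infDist_pt X).continuousOn
  have hzt : h + t ≤ Metric.infDist z X := by
    by_contra hcon
    push Not at hcon
    have htpos : 0 < t := by
      rcases ht.eq_or_lt with h0 | h0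
      · have : z = x := by
          rw [← h0] at hz; simpa using hz
        rw [this, ← h0] at hcon
        linarith
      · exact h0
    have key : ∀ η : ℝ, 0 < η → η < 1 → h + η * t ≤ Metric.infDist z X := by
      intro η h0 h1
      obtain ⟨w, hw, hw2⟩ := exists_infDist_add_le hX hne hx ht hu h1 h0
      exact hw2.trans (hzmax hw)
    -- If the maximal slope `a` were below `1`, a rate strictly between `max a 0` and `1` would
    -- contradict `key`.
    set a := (Metric.infDist z X - h) / t with ha
    have ha1 : a < 1 := by rw [ha, div_lt_one htpos]; linarith
    have h2 := key ((max a 0 + 1) / 2) (by positivity)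
      (by rcases max_cases a 0 with h | h <;> linarith [h.1])
    have h3 : a * t = Metric.infDist z X - h := by rw [ha]; field_simp
    nlinarith [le_max_left a 0, le_max_right a 0]
  have hxq : ‖x - q‖ = h := by rw [← dist_eq_norm]; exact hq.2
  set u : E k := h⁻¹ • (x - q) with hudef
  have hune : ‖u‖ = 1 := by
    rw [hudef, norm_smul, hxq, norm_inv, Real.norm_of_nonneg hx.le, inv_mul_cancel₀ hx.ne']
  have hxqu : x - q = h • u := by rw [hudef, smul_smul, mul_inv_cancel₀ hx.ne', one_smul]
  have hzx : ‖z - x‖ ≤ t := by rw [← dist_eq_norm]; exact hz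
  have hzq : h + t ≤ ‖z - q‖ := by
    rw [← dist_eq_norm]; exact hzt.trans (Metric.infDist_le_dist_of_mem hq.1)
  have e1 : ‖z - q‖ ^ 2 = ‖z - x‖ ^ 2 + 2 * (h * ⟪z - x, u⟫) + h ^ 2 := by
    rw [show z - q = (z - x) + h • u by rw [← hxqu]; abel, norm_add_sq_real,
      real_inner_smul_right, norm_smul, hune, Real.norm_of_nonneg hx.le, mul_one]
  have e2 : ‖(z - x) - t • u‖ ^ 2 = ‖z - x‖ ^ 2 - 2 * (t * ⟪z - x, u⟫) + t ^ 2 := by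
    rw [norm_sub_sq_real, real_inner_smul_right, norm_smul, hune, Real.norm_of_nonneg ht, mul_one]
  -- Equality case of the triangle inequality: `‖z - q‖ ≥ h + t` with `‖z - x‖ ≤ t` and `‖x - q‖ =
  -- h` forces the maximizer `z` onto the ray from `q` through `x`.
  have h3 : (h + t) ^ 2 ≤ ‖z - q‖ ^ 2 := by gcongr
  have h4 : ‖z - x‖ ^ 2 ≤ t ^ 2 := by gcongr
  have h5 : t ≤ ⟪z - x, u⟫ := by
    have : h * t ≤ h * ⟪z - x, u⟫ := by nlinarith
    exact le_of_mul_le_mul_left this hx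
  have h6 : ‖(z - x) - t • u‖ ^ 2 ≤ 0 := by nlinarith
  have h7 : (z - x) - t • u = 0 := by
    have : ‖(z - x) - t • u‖ = 0 := by nlinarith [norm_nonneg ((z - x) - t • u)]
    exact norm_eq_zero.mp this
  have h8 : z = x + t • u := by
    rw [sub_eq_zero] at h7; rw [← h7]; abel
  intro w hw
  rw [← h8]
  exact hzt.trans (Metric.infDist_le_dist_of_mem hw)

/-! ### Local structure of a submanifold, from slice charts -/

/-- A `C²` map is approximated by its derivative up to a quadratic error. -/
lemma exists_quadratic_bound {F G : Type*} [NormedAddCommGroup F] [NormedSpace ℝ F]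
    [NormedAddCommGroup G] [NormedSpace ℝ G] {g : F → G} {a : F} (hg : ContDiffAt ℝ 2 g a) :
    ∃ K : ℝ, 0 ≤ K ∧ ∀ᶠ w in 𝓝 a, ‖g w - g a - fderiv ℝ g a (w - a)‖ ≤ K * ‖w - a‖ ^ 2 := by
  have h1 : ContDiffAt ℝ 1 (fderiv ℝ g) a := hg.fderiv_right (by norm_num)
  obtain ⟨K, t, ht, hK⟩ := h1.exists_lipschitzOnWith
  have hd : ∀ᶠ w in 𝓝 a, DifferentiableAt ℝ g w := by
    filter_upwards [hg.eventually (by simp)] with w hw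
    exact hw.differentiableAt (by simp)
  obtain ⟨r, hr, hball⟩ := Metric.eventually_nhds_iff_ball.mp (hd.and ht)
  refine ⟨K, K.2, ?_⟩
  filter_upwards [Metric.ball_mem_nhds a hr] with w hw
  have hsub : ∀ x ∈ segment ℝ a w, ‖x - a‖ ≤ ‖w - a‖ := by
    intro x hx
    obtain ⟨θ, ⟨h0, h1⟩, rfl⟩ := (segment_eq_image' ℝ a w ▸ hx)
    simp only [add_sub_cancel_left, norm_smul, Real.norm_of_nonneg h0]
    exact mul_le_of_le_one_left (norm_nonneg _) h1
  have hw' : ‖w - a‖ < r := by rwa [← dist_eq_norm]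
  have hmem : ∀ x ∈ segment ℝ a w, x ∈ Metric.ball a r := fun x hx => by
    rw [Metric.mem_ball, dist_eq_norm]; exact (hsub x hx).trans_lt hw'
  have := (convex_segment a w).norm_image_sub_le_of_norm_hasFDerivWithin_le'
    (f := g) (f' := fderiv ℝ g) (φ := fderiv ℝ g a) (C := K * ‖w - a‖)
    (fun x hx => ((hball x (hmem x hx)).1.hasFDerivAt).hasFDerivWithinAt)
    (fun x hx => by
      have h := hK.dist_le_mul x (hball x (hmem x hx)).2 a (hball a (Metric.mem_ball_self hr)).2
      rw [dist_eq_norm, dist_eq_norm] at h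
      exact h.trans (mul_le_mul_of_nonneg_left (hsub x hx) K.2))
    (left_mem_segment ℝ a w) (right_mem_segment ℝ a w)
  calc _ ≤ _ := this
    _ = _ := by ring

/-- A smooth submanifold has a local parametrization over a linear space, whose derivative covers
the tangent vectors, and which approximates the submanifold to second order. -/
lemma IsSmoothSubmanifold.exists_parametrization {s : ℕ} {X : Set (E k)}
    (hXs : IsSmoothSubmanifold s X) {q : E k} (hq : q ∈ X) :
    ∃ (W : Submodule ℝ (E k)) (f : W → E k) (D : W →L[ℝ] E k) (w₀ : W),
      f w₀ = q ∧ HasStrictFDerivAt f D w₀ ∧ (∀ᶠ w in 𝓝 w₀, f w ∈ X) ∧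
      (∀ v ∈ tangentVectors X q, ∃ w, D w = v) ∧
      ∃ K : ℝ, 0 ≤ K ∧ ∀ᶠ z in 𝓝 q, z ∈ X → ∃ w, ‖z - q - D w‖ ≤ K * ‖z - q‖ ^ 2 := by
  obtain ⟨Φ, W, hqs, hΦ, hΨ, -, hW⟩ := hXs q hq
  have hsrc : Φ.source ∈ 𝓝 q := Φ.open_source.mem_nhds hqs
  have htq : Φ q ∈ Φ.target := Φ.map_source hqs
  have htgt : Φ.target ∈ 𝓝 (Φ q) := Φ.open_target.mem_nhds htq
  have hΦq : ContDiffAt ℝ ∞ Φ q := hΦ.contDiffAt hsrc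
  have hΨq : ContDiffAt ℝ ∞ Φ.symm (Φ q) := hΨ.contDiffAt htgt
  have hw₀ : Φ q ∈ W := (hW q hqs).mp hq
  have hinv : Φ.symm (Φ q) = q := Φ.left_inv hqs
  have hΦd : HasFDerivAt Φ (fderiv ℝ Φ q) q := (hΦq.differentiableAt (by simp)).hasFDerivAt
  have hΨd : HasStrictFDerivAt Φ.symm (fderiv ℝ Φ.symm (Φ q)) (Φ q) :=
    hΨq.hasStrictFDerivAt (by simp)
  set D₀ := fderiv ℝ Φ.symm (Φ q) with hD₀
  have hcomp : ∀ v, D₀ (fderiv ℝ Φ q v) = v := by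
    have h1 : HasFDerivAt (Φ.symm ∘ Φ) (D₀.comp (fderiv ℝ Φ q)) q :=
      hΨd.hasFDerivAt.comp q hΦd
    have h2 : HasFDerivAt (Φ.symm ∘ Φ) (ContinuousLinearMap.id ℝ (E k)) q := by
      apply (hasFDerivAt_id q).congr_of_eventuallyEq
      filter_upwards [hsrc] with z hz using Φ.left_inv hz
    intro v
    have := congrArg (fun L : E k →L[ℝ] E k => L v) (h1.unique h2)
    simpa using this
  refine ⟨W, fun w => Φ.symm w, D₀.comp W.subtypeL, ⟨Φ q, hw₀⟩, hinv, ?_, ?_, ?_, ?_⟩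
  · exact HasStrictFDerivAt.comp (x := (⟨Φ q, hw₀⟩ : W)) (f := W.subtypeL) hΨd
      W.subtypeL.hasStrictFDerivAt
  · have : ∀ᶠ w : W in 𝓝 ⟨Φ q, hw₀⟩, (w : E k) ∈ Φ.target :=
      continuous_subtype_val.continuousAt.eventually htgt
    filter_upwards [this] with w hw
    rw [hW _ (Φ.map_target hw), Φ.right_inv hw]
    exact w.2
  · rintro v ⟨γ, hγ0, hγX, hγd⟩
    have hd : HasDerivAt (fun t => Φ (γ t)) (fderiv ℝ Φ q v) 0 := by
      have : HasFDerivAt Φ (fderiv ℝ Φ q) (γ 0) := by rw [hγ0]; exact hΦd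
      exact this.comp_hasDerivAt 0 hγd
    have hγs : ∀ᶠ t in 𝓝 (0 : ℝ), γ t ∈ Φ.source :=
      hγd.continuousAt.eventually (by rw [hγ0]; exact hsrc)
    -- The difference quotients of `Φ ∘ γ` lie in `W`, which is closed.
    have hmem : fderiv ℝ Φ q v ∈ W := by
      rw [hasDerivAt_iff_tendsto_slope_zero] at hd
      refine (Submodule.closed_of_finiteDimensional W).mem_of_tendsto hd ?_
      have : ∀ᶠ t in 𝓝[≠] (0 : ℝ), γ t ∈ X ∧ γ t ∈ Φ.source :=
        (hγX.and hγs).filter_mono nhdsWithin_le_nhds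
      filter_upwards [this] with t ht
      apply W.smul_mem
      apply W.sub_mem
      · rw [zero_add]; exact (hW _ ht.2).mp ht.1
      · rw [hγ0]; exact hw₀
    exact ⟨⟨_, hmem⟩, hcomp v⟩
  · obtain ⟨K, hK0, hK⟩ := exists_quadratic_bound (contDiffAt_infty.mp hΨq 2)
    obtain ⟨C, hC0, hC⟩ := (hΦd.isBigO_sub).exists_pos
    have hC := hC.bound
    refine ⟨K * C ^ 2, by positivity, ?_⟩
    have hK' : ∀ᶠ z in 𝓝 q, ‖Φ.symm (Φ z) - Φ.symm (Φ q) - D₀ (Φ z - Φ q)‖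
        ≤ K * ‖Φ z - Φ q‖ ^ 2 := hΦd.continuousAt.eventually hK
    filter_upwards [hK', hC, hsrc] with z h1 h2 h3 hzX
    refine ⟨⟨Φ z, (hW z h3).mp hzX⟩ - ⟨Φ q, hw₀⟩, ?_⟩
    rw [Φ.left_inv h3, hinv] at h1
    calc _ ≤ _ := h1
      _ ≤ K * (C * ‖z - q‖) ^ 2 := by gcongr
      _ = _ := by ring

/-- Derivatives of parametrizations are tangent vectors. -/
lemma mem_tangentVectors_of_hasFDerivAt {X : Set (E k)} {F : Type*} [NormedAddCommGroup F]
    [NormedSpace ℝ F] {f : F → E k} {D : F →L[ℝ] E k} {w₀ : F} (hf : HasFDerivAt f D w₀)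
    (hX : ∀ᶠ w in 𝓝 w₀, f w ∈ X) (v : F) : D v ∈ tangentVectors X (f w₀) := by
  have hl : HasDerivAt (fun t : ℝ => w₀ + t • v) v 0 := by
    simpa using ((hasDerivAt_id (0 : ℝ)).smul_const v).const_add w₀
  refine ⟨fun t => f (w₀ + t • v), by simp, ?_, ?_⟩
  · have h : Filter.Tendsto (fun t : ℝ => w₀ + t • v) (𝓝 0) (𝓝 w₀) := by
      have := hl.continuousAt.tendsto
      simpa using this
    exact h.eventually hX
  · have hf' : HasFDerivAt f D (w₀ + (0 : ℝ) • v) := by simpa using hf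
    exact hf'.comp_hasDerivAt 0 hl

lemma inner_eq_zero_of_mem_normalSpace {X : Set (E k)} {x n v : E k} (hn : n ∈ normalSpace X x)
    (hv : v ∈ Submodule.span ℝ (tangentVectors X x)) : ⟪n, v⟫ = 0 := by
  rw [real_inner_comm]
  exact (Submodule.mem_orthogonal _ _).mp hn v hv

lemma mem_normalSpace_of_forall {X : Set (E k)} {x n : E k}
    (h : ∀ v ∈ tangentVectors X x, ⟪n, v⟫ = 0) : n ∈ normalSpace X x := by
  rw [normalSpace, Submodule.mem_orthogonal]
  intro v hv
  induction hv using Submodule.span_induction with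
  | mem v hv => rw [real_inner_comm]; exact h v hv
  | zero => simp
  | add a b _ _ ha hb => rw [inner_add_left, ha, hb, add_zero]
  | smul c a _ ha => rw [real_inner_smul_left, ha, mul_zero]

/-- Normal vectors admit a small tangent ball that misses the submanifold. -/
lemma IsSmoothSubmanifold.exists_small_tangent_ball {s : ℕ} {X : Set (E k)}
    (hXs : IsSmoothSubmanifold s X) {q n : E k} (hq : q ∈ X) (hn : n ∈ normalSpace X q) :
    ∃ r > 0, ∀ z ∈ X, 2 * r * ⟪n, z - q⟫ ≤ ‖z - q‖ ^ 2 := by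
  obtain ⟨W, f, D, w₀, hf, hD, hfX, -, K, hK0, hK⟩ := hXs.exists_parametrization hq
  obtain ⟨δ, hδ, hball⟩ := Metric.eventually_nhds_iff_ball.mp hK
  have hr1 : 0 < 2 * (‖n‖ * K + 1) := by positivity
  have hr2 : 0 < 2 * (‖n‖ + 1) := by positivity
  -- The inequality says that `z` is outside the open ball of radius `r * ‖n‖` centred at `q + r •
  -- n`. The first bound on `r` serves points near `q`, where the normal part is quadratic; the
  -- second serves far points, by Cauchy–Schwarz.
  refine ⟨min (1 / (2 * (‖n‖ * K + 1))) (δ / (2 * (‖n‖ + 1))), by positivity, fun z hz => ?_⟩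
  set r := min (1 / (2 * (‖n‖ * K + 1))) (δ / (2 * (‖n‖ + 1))) with hr
  have hr0 : 0 < r := by positivity
  have h1 : r * (2 * (‖n‖ * K + 1)) ≤ 1 := by
    rw [← le_div_iff₀ hr1]; exact min_le_left _ _
  have h2 : r * (2 * (‖n‖ + 1)) ≤ δ := by
    rw [← le_div_iff₀ hr2]; exact min_le_right _ _
  have hnn := norm_nonneg n
  have hzn := norm_nonneg (z - q)
  rcases lt_or_ge ‖z - q‖ δ with hzδ | hzδ
  · obtain ⟨w, hw⟩ := hball z (by rwa [Metric.mem_ball, dist_eq_norm]) hz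
    have h3 : ⟪n, D w⟫ = 0 := by
      apply inner_eq_zero_of_mem_normalSpace hn
      apply Submodule.subset_span
      rw [← hf]
      exact mem_tangentVectors_of_hasFDerivAt hD.hasFDerivAt hfX w
    have h4 : ⟪n, z - q⟫ ≤ ‖n‖ * (K * ‖z - q‖ ^ 2) := by
      calc ⟪n, z - q⟫ = ⟪n, z - q - D w⟫ := by rw [inner_sub_right _ (z - q), h3, sub_zero]
        _ ≤ ‖n‖ * ‖z - q - D w‖ := real_inner_le_norm _ _
        _ ≤ _ := by gcongr
    calc 2 * r * ⟪n, z - q⟫ ≤ 2 * r * (‖n‖ * (K * ‖z - q‖ ^ 2)) := by gcongr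
      _ = (r * (2 * (‖n‖ * K))) * ‖z - q‖ ^ 2 := by ring
      _ ≤ 1 * ‖z - q‖ ^ 2 := by gcongr; nlinarith
      _ = _ := one_mul _
  · calc 2 * r * ⟪n, z - q⟫ ≤ 2 * r * (‖n‖ * ‖z - q‖) := by
          gcongr; exact real_inner_le_norm _ _
      _ = (r * (2 * ‖n‖)) * ‖z - q‖ := by ring
      _ ≤ ‖z - q‖ * ‖z - q‖ := by gcongr; nlinarith
      _ = _ := by ring

/-- The orthogonal projection to the tangent space maps `X` near `p` onto a neighbourhood. -/
lemma IsSmoothSubmanifold.exists_local_section {s : ℕ} {X : Set (E k)}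
    (hXs : IsSmoothSubmanifold s X) {p : E k} (hp : p ∈ X) {ρ : ℝ} (hρ : 0 < ρ) :
    ∃ r > 0, ∀ a ∈ Submodule.span ℝ (tangentVectors X p), ‖a‖ ≤ r →
      ∃ q ∈ X, ‖q - p‖ ≤ ρ ∧
        (Submodule.span ℝ (tangentVectors X p)).starProjection (q - p) = a := by
  set T := Submodule.span ℝ (tangentVectors X p) with hT
  obtain ⟨W, f, D, w₀, hf, hD, hfX, hDT, -⟩ := hXs.exists_parametrization hp
  have hrange : T ≤ LinearMap.range (D : W →ₗ[ℝ] E k) := by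
    rw [hT, Submodule.span_le]
    intro v hv
    obtain ⟨w, hw⟩ := hDT v hv
    exact ⟨w, hw⟩
  set F : W → T := fun w => T.orthogonalProjectionOnto (f w - p) with hF
  have hFd : HasStrictFDerivAt F (T.orthogonalProjectionOnto.comp D) w₀ :=
    T.orthogonalProjectionOnto.hasStrictFDerivAt.comp w₀ (hD.sub_const p)
  -- A surjective strict derivative makes `F` map neighbourhoods of `w₀` onto neighbourhoods of `0`.
  have hsurj : (T.orthogonalProjectionOnto.comp D).range = ⊤ := by
    rw [LinearMap.range_eq_top]
    rintro ⟨a, ha⟩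
    obtain ⟨w, hw⟩ := hrange ha
    refine ⟨w, ?_⟩
    have hw' : D w = a := hw
    show T.orthogonalProjectionOnto (D w) = _
    rw [hw']
    exact Submodule.orthogonalProjectionOnto_mem_subspace_eq_self (⟨a, ha⟩ : T)
  have hmap := hFd.map_nhds_eq_of_surj hsurj
  have hF0 : F w₀ = 0 := by simp [hF, hf]
  rw [hF0] at hmap
  have hev : ∀ᶠ w in 𝓝 w₀, f w ∈ X ∧ f w ∈ Metric.closedBall p ρ :=
    hfX.and (hD.hasFDerivAt.continuousAt.eventually
      (by rw [hf]; exact Metric.closedBall_mem_nhds p hρ))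
  have himg : F '' {w | f w ∈ X ∧ f w ∈ Metric.closedBall p ρ} ∈ 𝓝 (0 : T) := by
    rw [← hmap]; exact Filter.image_mem_map hev
  obtain ⟨r, hr, hball⟩ := Metric.mem_nhds_iff.mp himg
  refine ⟨r / 2, by positivity, fun a ha har => ?_⟩
  have : (⟨a, ha⟩ : T) ∈ Metric.ball (0 : T) r := by
    rw [mem_ball_zero_iff]
    show ‖a‖ < r
    linarith
  obtain ⟨w, ⟨hw1, hw2⟩, hw3⟩ := hball this
  refine ⟨f w, hw1, by rw [← dist_eq_norm]; exact hw2, ?_⟩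
  have := congrArg (Subtype.val) hw3
  exact this

/-! ### Tangent balls of radius up to the local feature size -/

/-- The tangent space, as the span of the velocities of curves. -/
abbrev tangentSpan (X : Set (E k)) (x : E k) : Submodule ℝ (E k) :=
  Submodule.span ℝ (tangentVectors X x)

lemma subsingleton_closestPoints_of_notMem {X : Set (E k)} {x : E k} (hx : x ∉ medialAxis X) :
    (closestPoints X x).Subsingleton := by
  rw [← Set.not_nontrivial_iff]
  exact fun h => hx (subset_closure h)

lemma ofReal_sub_dist_le_lfs {X : Set (E k)} {p q : E k} {l : ℝ}
    (h : ENNReal.ofReal l ≤ lfs X p) : ENNReal.ofReal (l - dist p q) ≤ lfs X q := by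
  rw [ENNReal.ofReal_sub _ dist_nonneg, tsub_le_iff_right, ← edist_dist]
  exact h.trans Metric.infEDist_le_infEDist_add_edist

lemma norm_sub_sq_of_unit {u : E k} (hu : ‖u‖ = 1) (q : E k) (c : ℝ) (w : E k) :
    ‖(q + c • u) - w‖ ^ 2 = c ^ 2 - 2 * c * ⟪u, w - q⟫ + ‖w - q‖ ^ 2 := by
  rw [show (q + c • u) - w = c • u - (w - q) by abel, norm_sub_sq_real, norm_smul, hu,
    real_inner_smul_left, mul_one, Real.norm_eq_abs, sq_abs]
  ring

/-- Tangent balls of radius at most the local feature size do not meet the submanifold. -/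
lemma IsSmoothSubmanifold.inner_le_of_lfs {s : ℕ} {X : Set (E k)} (hXs : IsSmoothSubmanifold s X)
    (hX : IsCompact X) {q n : E k} (hq : q ∈ X) (hn : n ∈ normalSpace X q) {l : ℝ} (hl0 : 0 ≤ l)
    (hl : ENNReal.ofReal l ≤ lfs X q) {z : E k} (hz : z ∈ X) :
    2 * l * ⟪n, z - q⟫ ≤ ‖z - q‖ ^ 2 * ‖n‖ := by
  rcases eq_or_ne n 0 with rfl | hn0
  · simp
  have hnpos : 0 < ‖n‖ := norm_pos_iff.mpr hn0
  set u : E k := ‖n‖⁻¹ • n with hu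
  have hun : ‖u‖ = 1 := by rw [hu, norm_smul, norm_inv, norm_norm, inv_mul_cancel₀ hnpos.ne']
  have huN : u ∈ normalSpace X q := Submodule.smul_mem _ _ hn
  have hnu : n = ‖n‖ • u := by rw [hu, smul_smul, mul_inv_cancel₀ hnpos.ne', one_smul]
  obtain ⟨r, hr, hball⟩ := hXs.exists_small_tangent_ball hq huN
  have key : ∀ ρ, 0 < ρ → ρ < l → 2 * ρ * ⟪u, z - q⟫ ≤ ‖z - q‖ ^ 2 := by
    intro ρ hρ hρl
    set a := min r ρ with ha
    have ha0 : 0 < a := lt_min hr hρ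
    have haρ : a ≤ ρ := min_le_right _ _
    have expand := norm_sub_sq_of_unit hun q
    have hfar : ∀ w ∈ X, a ≤ dist (q + a • u) w := by
      intro w hw
      have h1 : 2 * a * ⟪u, w - q⟫ ≤ ‖w - q‖ ^ 2 := by
        rcases le_total 0 ⟪u, w - q⟫ with h0 | h0
        · have h2 : a * ⟪u, w - q⟫ ≤ r * ⟪u, w - q⟫ :=
            mul_le_mul_of_nonneg_right (min_le_left _ _) h0
          linarith [hball w hw]
        · nlinarith [sq_nonneg ‖w - q‖, mul_nonneg ha0.le (neg_nonneg.mpr h0)]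
      rw [dist_eq_norm]
      have h2 := expand a w
      exact (pow_le_pow_iff_left₀ ha0.le (norm_nonneg _) two_ne_zero).mp (by linarith)
    have hdq : dist (q + a • u) q = a := by
      rw [dist_eq_norm, add_sub_cancel_left, norm_smul, hun, mul_one, Real.norm_of_nonneg ha0.le]
    have hinf : Metric.infDist (q + a • u) X = a := by
      apply le_antisymm
      · exact (Metric.infDist_le_dist_of_mem hq).trans hdq.le
      · exact (Metric.le_infDist ⟨q, hq⟩).mpr (fun {w} hw => hfar w hw)
    have hqc : q ∈ closestPoints X (q + a • u) := ⟨hq, by rw [hdq, hinf]⟩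
    -- The ball of radius `ρ - a` about `q + a • u` lies within distance `ρ < l` of `q`, hence
    -- misses the medial axis. The empty tangent ball therefore grows from radius `a` to `ρ`.
    have hray := closestPoints_ray hX (by rw [hinf]; exact ha0) hqc (t := ρ - a) (by linarith)
      (fun w hw => by
        apply subsingleton_closestPoints_of_notMem
        intro hwM
        have h1 : lfs X q ≤ edist q w := Metric.infEDist_le_edist_of_mem hwM
        have h2 : dist q w ≤ ρ := by
          have := dist_triangle q (q + a • u) w
          rw [Metric.mem_closedBall] at hw
          rw [dist_comm q (q + a • u), hdq] at this
          linarith [dist_comm (q + a • u) w]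
        have h3 := hl.trans h1
        rw [edist_dist, ENNReal.ofReal_le_ofReal_iff dist_nonneg] at h3
        linarith) z hz
    rw [hinf, add_sub_cancel_left, smul_smul a⁻¹, inv_mul_cancel₀ ha0.ne', one_smul, add_assoc,
      ← add_smul, add_sub_cancel, dist_eq_norm] at hray
    have h2 := expand ρ z
    have h3 : ρ ^ 2 ≤ ‖(q + ρ • u) - z‖ ^ 2 := by gcongr
    linarith
  have hle : 2 * l * ⟪u, z - q⟫ ≤ ‖z - q‖ ^ 2 := by
    by_contra hcon
    push Not at hcon
    have hc : 0 < ⟪u, z - q⟫ := by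
      by_contra h
      push Not at h
      linarith [sq_nonneg ‖z - q‖, mul_nonneg hl0 (neg_nonneg.mpr h)]
    set d := ‖z - q‖ ^ 2 / (2 * ⟪u, z - q⟫) with hd
    have hd0 : 0 ≤ d := by positivity
    have hdl : d < l := by rw [hd, div_lt_iff₀ (by positivity)]; linarith
    have h1 := key ((d + l) / 2) (by linarith) (by linarith)
    have h2 : d * (2 * ⟪u, z - q⟫) = ‖z - q‖ ^ 2 := by rw [hd]; field_simp
    nlinarith
  rw [hnu, real_inner_smul_left, norm_smul, norm_norm, hun, mul_one]
  calc _ = ‖n‖ * (2 * l * ⟪u, z - q⟫) := by ring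
    _ ≤ ‖n‖ * ‖z - q‖ ^ 2 := by gcongr
    _ = _ := mul_comm _ _

/-! ### Chords, tangential projections and the variation of normal spaces -/

lemma inner_starProjection_eq {T : Submodule ℝ (E k)} {v : E k} (hv : v ∈ T) (x : E k) :
    ⟪v, T.starProjection x⟫ = ⟪v, x⟫ := by
  rw [← Submodule.inner_starProjection_left_eq_right, Submodule.starProjection_eq_self_iff.mpr hv]

/-- The normal component of a chord is quadratically small. -/
lemma IsSmoothSubmanifold.norm_sub_starProjection_le {s : ℕ} {X : Set (E k)}
    (hXs : IsSmoothSubmanifold s X) (hX : IsCompact X) {p q : E k} (hp : p ∈ X) (hq : q ∈ X)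
    {l : ℝ} (hl0 : 0 ≤ l) (hl : ENNReal.ofReal l ≤ lfs X p) :
    2 * l * ‖(q - p) - (tangentSpan X p).starProjection (q - p)‖ ≤ ‖q - p‖ ^ 2 := by
  set b := (q - p) - (tangentSpan X p).starProjection (q - p) with hb
  have hbN : b ∈ normalSpace X p := Submodule.sub_starProjection_mem_orthogonal _
  have h1 := hXs.inner_le_of_lfs hX hp hbN hl0 hl hq
  have h2 : ⟪b, q - p⟫ = ‖b‖ ^ 2 := by
    have h3 : q - p = b + (tangentSpan X p).starProjection (q - p) := by rw [hb]; abel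
    rw [h3, inner_add_right, real_inner_self_eq_norm_sq,
      inner_eq_zero_of_mem_normalSpace hbN (Submodule.starProjection_apply_mem _ _), add_zero]
  rw [h2] at h1
  rcases (norm_nonneg b).eq_or_lt with h0 | h0
  · rw [← h0]; simp
  · exact le_of_mul_le_mul_right (by linarith) h0

/-- The projection of `X ∩ closedBall p ρ` to the tangent space at `p` covers the ball of
radius `r`. -/
def TangentCover (X : Set (E k)) (p : E k) (ρ r : ℝ) : Prop :=
  ∀ a ∈ tangentSpan X p, ‖a‖ ≤ r →
    ∃ q ∈ X, ‖q - p‖ ≤ ρ ∧ (tangentSpan X p).starProjection (q - p) = a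

lemma hasDerivAt_starProjection_curve {T : Submodule ℝ (E k)} {γ : ℝ → E k} {v p a : E k}
    (hγ : HasDerivAt γ v 0) :
    HasDerivAt (fun t => ‖T.starProjection (γ t - p) - a‖ ^ 2)
      (2 * ⟪T.starProjection (γ 0 - p) - a, T.starProjection v⟫) 0 := by
  have h1 : HasDerivAt (fun t => T.starProjection (γ t - p) - a) (T.starProjection v) 0 :=
    ((T.starProjection.hasFDerivAt (x := γ 0 - p)).comp_hasDerivAt 0
      (hγ.sub_const p)).sub_const a
  exact h1.norm_sq

/-- Continuity method with a definite gain. If `a` is missed, take `q` in `X` near `p` whose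
projection is nearest to `a`. The error `e` is then tangent at `p` but normal at `q`. Moving from
`p` by `r` in the direction of `e` is possible within `X`, by the covering already known, yet the
tangent balls at `q` allow `X` to move in that direction only by order `r ^ 2 / l`. -/
lemma IsSmoothSubmanifold.tangentCover_step {s : ℕ} {X : Set (E k)}
    (hXs : IsSmoothSubmanifold s X) (hX : IsCompact X) {p : E k} (hp : p ∈ X)
    {l : ℝ} (hl0 : 0 < l) (hl : ENNReal.ofReal l ≤ lfs X p) {r r' : ℝ} (hr : 0 < r)
    (hrr : r' ≤ 5 / 4 * r) (hrl : r' ≤ l / 15) (hrl' : r ≤ l / 15)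
    (hc : TangentCover X p (l / 8) r) : TangentCover X p (l / 8) r' := by
  intro a haT har
  by_contra hno
  push Not at hno
  set T := tangentSpan X p with hT
  rcases le_or_gt ‖a‖ r with h | hra
  · obtain ⟨q, hq, h1, h2⟩ := hc a haT h
    exact hno q hq h1 h2
  have hcomp : IsCompact (X ∩ Metric.closedBall p (l / 8)) :=
    hX.inter_right Metric.isClosed_closedBall
  obtain ⟨q, ⟨hqX, hqb⟩, hqmin⟩ := hcomp.exists_isMinOn
    ⟨p, hp, Metric.mem_closedBall_self (by positivity)⟩
    (f := fun z => ‖T.starProjection (z - p) - a‖ ^ 2) (by fun_prop)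
  have hqb' : ‖q - p‖ ≤ l / 8 := by rw [← dist_eq_norm]; exact hqb
  set e := T.starProjection (q - p) - a with he
  have heT : e ∈ T := T.sub_mem (Submodule.starProjection_apply_mem _ _) haT
  have he0 : e ≠ 0 := fun h => hno q hqX hqb' (sub_eq_zero.mp h)
  have hapos : 0 < ‖a‖ := hr.trans hra
  -- Compare with a point of `X` over the radial rescaling of `a` to length `r`.
  have hesmall : ‖e‖ ≤ r / 4 := by
    obtain ⟨z, hzX, hzb, hz⟩ := hc ((r / ‖a‖) • a) (T.smul_mem _ haT)
      (by rw [norm_smul, norm_div, norm_norm, Real.norm_of_nonneg hr.le,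
            div_mul_cancel₀ _ hapos.ne'])
    have h1 : ‖e‖ ^ 2 ≤ ‖T.starProjection (z - p) - a‖ ^ 2 :=
      hqmin ⟨hzX, by rwa [Metric.mem_closedBall, dist_eq_norm]⟩
    have h2 : ‖T.starProjection (z - p) - a‖ = ‖a‖ - r := by
      rw [hz, show (r / ‖a‖) • a - a = (r / ‖a‖ - 1) • a by rw [sub_smul, one_smul], norm_smul,
        Real.norm_eq_abs, abs_of_nonpos (by rw [sub_nonpos, div_le_one hapos]; exact hra.le)]
      field_simp
      ring
    have h3 := (pow_le_pow_iff_left₀ (norm_nonneg _) (norm_nonneg _) two_ne_zero).mp h1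
    linarith
  have bound : ∀ z ∈ X, ‖z - p‖ ≤ l / 8 →
      ‖z - p‖ * (15 / 16) ≤ ‖T.starProjection (z - p)‖ := by
    intro z hz hzl
    have h1 := hXs.norm_sub_starProjection_le hX hp hz hl0.le hl
    have h2 : ‖z - p‖ ≤ ‖(z - p) - T.starProjection (z - p)‖ + ‖T.starProjection (z - p)‖ := by
      simpa using norm_add_le ((z - p) - T.starProjection (z - p)) (T.starProjection (z - p))
    have h3 : 2 * l * ‖(z - p) - T.starProjection (z - p)‖ ≤ 2 * l * (‖z - p‖ / 16) := by
      nlinarith [norm_nonneg (z - p)]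
    have h4 := le_of_mul_le_mul_left h3 (by positivity)
    linarith
  have hPq : ‖T.starProjection (q - p)‖ ≤ 3 / 2 * r := by
    have : T.starProjection (q - p) = e + a := by rw [he]; abel
    rw [this]
    linarith [norm_add_le e a]
  have hqp : ‖q - p‖ ≤ 8 / 5 * r := by
    have := bound q hqX hqb'
    linarith
  -- Since `8 / 5 * r < l / 8`, the minimizer is interior to the ball, and the first-order condition
  -- holds along every curve in `X`.
  have heN : e ∈ normalSpace X q := by
    apply mem_normalSpace_of_forall
    rintro v ⟨γ, hγ0, hγX, hγd⟩
    have hmin : IsLocalMin (fun t => ‖T.starProjection (γ t - p) - a‖ ^ 2) 0 := by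
      have hball : ∀ᶠ t in 𝓝 (0 : ℝ), γ t ∈ Metric.closedBall p (l / 8) := by
        apply hγd.continuousAt.eventually
        rw [hγ0]
        apply Metric.closedBall_mem_nhds_of_mem
        rw [Metric.mem_ball, dist_eq_norm]
        linarith
      filter_upwards [hγX, hball] with t h1 h2
      rw [hγ0]
      exact hqmin ⟨h1, h2⟩
    have h := hmin.hasDerivAt_eq_zero (hasDerivAt_starProjection_curve hγd)
    rw [hγ0, inner_starProjection_eq heT] at h
    linarith
  have hepos : 0 < ‖e‖ := norm_pos_iff.mpr he0
  set u : E k := ‖e‖⁻¹ • e with hu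
  have hun : ‖u‖ = 1 := by rw [hu, norm_smul, norm_inv, norm_norm, inv_mul_cancel₀ hepos.ne']
  have huT : u ∈ T := T.smul_mem _ heT
  have huN : u ∈ normalSpace X q := Submodule.smul_mem _ _ heN
  obtain ⟨z, hzX, hzb, hz⟩ := hc (r • u) (T.smul_mem _ huT)
    (by rw [norm_smul, hun, Real.norm_of_nonneg hr.le, mul_one])
  have hzp : ‖z - p‖ ≤ 16 / 15 * r := by
    have := bound z hzX hzb
    rw [hz, norm_smul, hun, Real.norm_of_nonneg hr.le] at this
    linarith
  have hlq : ENNReal.ofReal (7 / 8 * l) ≤ lfs X q := by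
    refine le_trans (ENNReal.ofReal_le_ofReal ?_) (ofReal_sub_dist_le_lfs (q := q) hl)
    rw [dist_comm, dist_eq_norm]
    linarith
  have t1 := hXs.inner_le_of_lfs hX hqX huN (by positivity) hlq hzX
  have t2 := hXs.inner_le_of_lfs hX hqX (Submodule.neg_mem _ huN) (by positivity) hlq hp
  have hzu : ⟪u, z - p⟫ = r := by
    rw [← inner_starProjection_eq huT, hz, real_inner_smul_right, real_inner_self_eq_norm_sq, hun]
    ring
  have hsplit : ⟪u, z - q⟫ + ⟪-u, p - q⟫ = r := by
    rw [← hzu, inner_neg_left, ← sub_eq_add_neg, ← inner_sub_right]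
    congr 1; abel
  rw [hun, mul_one] at t1
  rw [norm_neg, hun, mul_one, norm_sub_rev] at t2
  have hzq : ‖z - q‖ ≤ 8 / 3 * r := by
    have : ‖z - q‖ ≤ ‖z - p‖ + ‖q - p‖ := by
      rw [show z - q = (z - p) - (q - p) by abel]; exact norm_sub_le _ _
    linarith
  have s1 : ‖z - q‖ ^ 2 ≤ (8 / 3 * r) ^ 2 := by gcongr
  have s2 : ‖q - p‖ ^ 2 ≤ (8 / 5 * r) ^ 2 := by gcongr
  -- `(8/3)² + (8/5)² < 10`. With the sum equal to `r` this gives `7/4 * l ≤ 10 * r`, against `r ≤ l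
  -- / 15`.
  have s3 : 2 * (7 / 8 * l) * (⟪u, z - q⟫ + ⟪-u, p - q⟫) ≤ 10 * r ^ 2 := by
    rw [mul_add]; nlinarith
  rw [hsplit] at s3
  nlinarith [mul_pos hr hr]

/-- Quantitative size of the tangential projection of a submanifold. -/
lemma IsSmoothSubmanifold.tangentCover {s : ℕ} {X : Set (E k)}
    (hXs : IsSmoothSubmanifold s X) (hX : IsCompact X) {p : E k} (hp : p ∈ X)
    {l : ℝ} (hl0 : 0 < l) (hl : ENNReal.ofReal l ≤ lfs X p) :
    TangentCover X p (l / 8) (l / 15) := by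
  obtain ⟨r, hr, hloc⟩ := hXs.exists_local_section hp (show 0 < l / 8 by positivity)
  have main : ∀ n : ℕ, TangentCover X p (l / 8) (min ((5 / 4) ^ n * r) (l / 15)) := by
    intro n
    induction n with
    | zero =>
      intro a ha har
      exact hloc a ha (har.trans (by simp))
    | succ n ih =>
      refine hXs.tangentCover_step hX hp hl0 hl (r := min ((5 / 4) ^ n * r) (l / 15))
        (by positivity) ?_ (min_le_right _ _) (min_le_right _ _) ih
      rw [mul_min_of_nonneg _ _ (by norm_num : (0 : ℝ) ≤ 5 / 4)]
      apply min_le_min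
      · rw [pow_succ]; apply le_of_eq; ring
      · linarith
  obtain ⟨n, hn⟩ := pow_unbounded_of_one_lt (l / 15 / r) (by norm_num : (1 : ℝ) < 5 / 4)
  have h := main n
  rwa [min_eq_right] at h
  rw [div_lt_iff₀ hr] at hn
  exact hn.le

/-- Normal vectors at a point are almost normal at nearby points. -/
lemma IsSmoothSubmanifold.inner_normal_tangent_le {s : ℕ} {X : Set (E k)}
    (hXs : IsSmoothSubmanifold s X) (hX : IsCompact X) {y p : E k} (hy : y ∈ X) (hp : p ∈ X)
    {l ε : ℝ} (hl0 : 0 < l) (hl : ENNReal.ofReal l ≤ lfs X y) (hε : 0 < ε) (hε1 : ε ≤ 1 / 16)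
    (hyp : dist y p ≤ ε * l) {n τ : E k} (hn : n ∈ normalSpace X y)
    (hτ : τ ∈ tangentSpan X p) : ⟪n, τ⟫ ≤ 13 / 4 * ε * ‖n‖ * ‖τ‖ := by
  rcases eq_or_ne τ 0 with rfl | hτ0
  · simp
  have hτpos : 0 < ‖τ‖ := norm_pos_iff.mpr hτ0
  set T := tangentSpan X p with hT
  have hlp : ENNReal.ofReal (15 / 16 * l) ≤ lfs X p := by
    refine le_trans (ENNReal.ofReal_le_ofReal ?_) (ofReal_sub_dist_le_lfs (q := p) hl)
    nlinarith
  have hεl : 0 < ε * l := by positivity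
  -- Probe the direction `τ` at scale `ε * l`, comparable to `d(y, p)`. As `ε ≤ 1/16`, this length
  -- is within the covering radius `(15/16 * l) / 15`.
  set a : E k := (ε * l / ‖τ‖) • τ with ha
  have han : ‖a‖ = ε * l := by
    rw [ha, norm_smul, Real.norm_of_nonneg (by positivity), div_mul_cancel₀ _ hτpos.ne']
  obtain ⟨q, hqX, hqb, hqa⟩ := hXs.tangentCover hX hp (by positivity) hlp a (T.smul_mem _ hτ)
    (by rw [han]; nlinarith)
  have hb := hXs.norm_sub_starProjection_le hX hp hqX (by positivity) hlp
  rw [hqa] at hb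
  set b := (q - p) - a with hbdef
  have hD : ‖q - p‖ ≤ 16 / 15 * (ε * l) := by
    have h2 : ‖q - p‖ ≤ ‖b‖ + ‖a‖ := by
      simpa [hbdef] using norm_add_le b a
    have h3 : 2 * (15 / 16 * l) * ‖b‖ ≤ 2 * (15 / 16 * l) * (‖q - p‖ / 16) := by
      nlinarith [norm_nonneg (q - p)]
    have h4 := le_of_mul_le_mul_left h3 (by positivity)
    linarith
  have hyp' : ‖p - y‖ ≤ ε * l := by rwa [← dist_eq_norm, dist_comm]
  have hqy : ‖q - y‖ ≤ 31 / 15 * (ε * l) := by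
    have : ‖q - y‖ ≤ ‖q - p‖ + ‖p - y‖ := by
      rw [show q - y = (q - p) + (p - y) by abel]; exact norm_add_le _ _
    linarith
  have t1 := hXs.inner_le_of_lfs hX hy hn hl0.le hl hqX
  have t2 := hXs.inner_le_of_lfs hX hy (Submodule.neg_mem _ hn) hl0.le hl hp
  rw [norm_neg, inner_neg_left] at t2
  have t3 : -⟪n, b⟫ ≤ ‖n‖ * ‖b‖ := by
    rw [← inner_neg_right, ← norm_neg b]; exact real_inner_le_norm _ _
  have hna : ⟪n, a⟫ = ⟪n, q - y⟫ - ⟪n, p - y⟫ - ⟪n, b⟫ := by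
    rw [← inner_sub_right, ← inner_sub_right]
    congr 1; rw [hbdef]; abel
  have s1 : ‖q - y‖ ^ 2 * ‖n‖ ≤ (31 / 15 * (ε * l)) ^ 2 * ‖n‖ := by gcongr
  have s2 : ‖p - y‖ ^ 2 * ‖n‖ ≤ (ε * l) ^ 2 * ‖n‖ := by gcongr
  have s3 : 2 * (15 / 16 * l) * ‖b‖ ≤ (16 / 15 * (ε * l)) ^ 2 := hb.trans (by gcongr)
  have s4 : l * ‖b‖ ≤ 8 / 15 * (16 / 15 * (ε * l)) ^ 2 := by linarith
  have s5 : l * (‖n‖ * ‖b‖) ≤ ‖n‖ * (8 / 15 * (16 / 15 * (ε * l)) ^ 2) := by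
    calc _ = ‖n‖ * (l * ‖b‖) := by ring
      _ ≤ _ := by gcongr
  have s6 : l * (-⟪n, b⟫) ≤ l * (‖n‖ * ‖b‖) := by gcongr
  have hn0 := norm_nonneg n
  -- The constant bounds `(31/15)²/2 + 1/2 + 8/15 * (16/15)²`: the contributions of `q - y`, `p - y`
  -- and the normal part `b`.
  have hfin : l * ⟪n, a⟫ ≤ 13 / 4 * ((ε * l) ^ 2 * ‖n‖) := by
    rw [hna]
    have : 0 ≤ (ε * l) ^ 2 * ‖n‖ := by positivity
    linarith
  rw [ha, real_inner_smul_right] at hfin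
  have h1 : ε * l ^ 2 / ‖τ‖ * ⟪n, τ⟫ ≤ ε * l ^ 2 / ‖τ‖ * (13 / 4 * ε * ‖n‖ * ‖τ‖) := by
    calc _ = l * (ε * l / ‖τ‖ * ⟪n, τ⟫) := by ring
      _ ≤ _ := hfin
      _ = _ := by field_simp
  exact le_of_mul_le_mul_left h1 (by positivity)

open InnerProductGeometry


/-! ### Angles -/

lemma real_inner_starProjection_self (U : Submodule ℝ (E k)) (v : E k) :
    ⟪v, U.starProjection v⟫ = ‖U.starProjection v‖ ^ 2 := by
  rw [real_inner_comm, ← inner_starProjection_eq (Submodule.starProjection_apply_mem U v) v,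
    real_inner_self_eq_norm_sq]

lemma norm_mul_cos_lineAngle (U : Submodule ℝ (E k)) (v : E k) :
    ‖v‖ * Real.cos (lineAngle U v) = ‖U.starProjection v‖ := by
  rcases eq_or_ne (U.starProjection v) 0 with h | h
  · rw [lineAngle, h]; simp
  · have h1 := cos_angle_mul_norm_mul_norm v (U.starProjection v)
    rw [real_inner_starProjection_self] at h1
    have h2 : 0 < ‖U.starProjection v‖ := norm_pos_iff.mpr h
    apply mul_right_cancel₀ h2.ne'
    rw [lineAngle]
    linarith

lemma lineAngle_le_pi_div_two (U : Submodule ℝ (E k)) (v : E k) :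
    lineAngle U v ≤ Real.pi / 2 := by
  rw [lineAngle, angle, Real.arccos_le_pi_div_two, real_inner_starProjection_self]
  positivity

lemma lineAngle_le_angle {U : Submodule ℝ (E k)} {u : E k} (hu : u ∈ U) (v : E k) :
    lineAngle U v ≤ angle v u := by
  rcases eq_or_ne v 0 with rfl | hv
  · rw [angle_zero_left]; exact lineAngle_le_pi_div_two U 0
  rcases eq_or_ne u 0 with rfl | hu0
  · rw [angle_zero_right]; exact lineAngle_le_pi_div_two U v
  have hvp : 0 < ‖v‖ := norm_pos_iff.mpr hv
  have hup : 0 < ‖u‖ := norm_pos_iff.mpr hu0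
  by_contra hcon
  push Not at hcon
  have h1 := Real.cos_lt_cos_of_nonneg_of_le_pi (angle_nonneg v u) (angle_le_pi _ _) hcon
  have h2 := norm_mul_cos_lineAngle U v
  have h3 := cos_angle_mul_norm_mul_norm v u
  have h4 : ⟪v, u⟫ ≤ ‖u‖ * ‖U.starProjection v‖ := by
    rw [real_inner_comm, ← inner_starProjection_eq hu v]; exact real_inner_le_norm _ _
  rw [← h2, ← h3] at h4
  have h5 : 0 < ‖u‖ * ‖v‖ := by positivity
  rw [lineAngle] at h4
  nlinarith [mul_lt_mul_of_pos_left h1 h5]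

lemma lineAngle_neg (U : Submodule ℝ (E k)) (v : E k) : lineAngle U (-v) = lineAngle U v := by
  rw [lineAngle, lineAngle, map_neg, angle_neg_neg]

lemma lineAngle_le_maxLineAngle {W : Submodule ℝ (E k)} (U : Submodule ℝ (E k)) {w : E k}
    (hw : w ∈ W) (hw0 : w ≠ 0) : lineAngle U w ≤ maxLineAngle W U := by
  apply le_csSup
  · refine ⟨Real.pi, ?_⟩
    rintro a ⟨u, -, -, rfl⟩
    exact angle_le_pi _ _
  · exact ⟨w, hw, hw0, rfl⟩

/-- Triangle inequality for angles, through the projection of `v` to `W` and then to `U`. -/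
lemma lineAngle_le_add {U W : Submodule ℝ (E k)} {ν : ℝ} (hν : 0 ≤ ν)
    (h : maxLineAngle W U ≤ ν) (v : E k) : lineAngle U v ≤ lineAngle W v + ν := by
  rcases eq_or_ne (W.starProjection v) 0 with h0 | h0
  · have : lineAngle W v = Real.pi / 2 := by rw [lineAngle, h0, angle_zero_right]
    rw [this]
    linarith [lineAngle_le_pi_div_two U v]
  · have h1 := lineAngle_le_angle
      (Submodule.starProjection_apply_mem U (W.starProjection v)) v
    have h2 := angle_le_angle_add_angle v (W.starProjection v)
      (U.starProjection (W.starProjection v))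
    have h3 := lineAngle_le_maxLineAngle U (Submodule.starProjection_apply_mem W v) h0
    simp only [lineAngle] at *
    linarith

lemma angle_le_of_sq_le {u v : E k} (hu : u ≠ 0) (hv : v ≠ 0) {κ φ : ℝ} (hκ : 0 ≤ κ)
    (hφ0 : 0 ≤ φ) (hκφ : κ ≤ Real.sin φ) (h0 : 0 ≤ ⟪u, v⟫)
    (h : (1 - κ ^ 2) * (‖u‖ ^ 2 * ‖v‖ ^ 2) ≤ ⟪u, v⟫ ^ 2) : angle u v ≤ φ := by
  by_contra hcon
  push Not at hcon
  have hup : 0 < ‖u‖ := norm_pos_iff.mpr hu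
  have hvp : 0 < ‖v‖ := norm_pos_iff.mpr hv
  have h1 := Real.cos_lt_cos_of_nonneg_of_le_pi hφ0 (angle_le_pi u v) hcon
  have h2 := cos_angle_mul_norm_mul_norm u v
  have h3 : 0 ≤ Real.cos (angle u v) := by
    rw [cos_angle]; positivity
  have h4 : Real.cos (angle u v) ^ 2 < Real.cos φ ^ 2 := by gcongr
  have h5 : κ ^ 2 ≤ Real.sin φ ^ 2 := by gcongr
  rw [← h2] at h
  have h6 : 1 - κ ^ 2 ≤ Real.cos (angle u v) ^ 2 := by
    have hpos : 0 < ‖u‖ ^ 2 * ‖v‖ ^ 2 := by positivity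
    refine le_of_mul_le_mul_right (h.trans (le_of_eq ?_)) hpos
    ring
  linarith [Real.sin_sq_add_cos_sq φ]

/-- The ball of radius `κ * ‖v‖` about `v` is seen from the origin under half-angle `arcsin κ`. The
squared form follows from `(a + b)² ≥ 4ab`. -/
lemma angle_le_of_norm_sub_le {u v : E k} (hv : v ≠ 0) {κ φ : ℝ} (hκ : 0 ≤ κ) (hκ1 : κ < 1)
    (hφ0 : 0 ≤ φ) (hκφ : κ ≤ Real.sin φ) (h : ‖u - v‖ ≤ κ * ‖v‖) :
    angle u v ≤ φ := by
  have hvp : 0 < ‖v‖ := norm_pos_iff.mpr hv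
  have hu : u ≠ 0 := by
    rintro rfl
    rw [zero_sub, norm_neg] at h
    nlinarith
  have h1 : ‖u - v‖ ^ 2 ≤ (κ * ‖v‖) ^ 2 := by gcongr
  rw [norm_sub_sq_real] at h1
  have hκ2 : 0 ≤ 1 - κ ^ 2 := by nlinarith
  have h2 : ‖u‖ ^ 2 + (1 - κ ^ 2) * ‖v‖ ^ 2 ≤ 2 * ⟪u, v⟫ := by linarith
  have h3 : 0 ≤ (1 - κ ^ 2) * ‖v‖ ^ 2 := by positivity
  have h0 : 0 ≤ ⟪u, v⟫ := by nlinarith [sq_nonneg ‖u‖]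
  refine angle_le_of_sq_le hu hv hκ hφ0 hκφ h0 ?_
  have h4 : (‖u‖ ^ 2 + (1 - κ ^ 2) * ‖v‖ ^ 2) ^ 2 ≤ (2 * ⟪u, v⟫) ^ 2 := by gcongr
  nlinarith [sq_nonneg (‖u‖ ^ 2 - (1 - κ ^ 2) * ‖v‖ ^ 2)]

lemma lineAngle_orthogonal_le {T : Submodule ℝ (E k)} {v : E k} (hv : v ≠ 0) {κ φ : ℝ}
    (hκ : 0 ≤ κ) (hκ1 : κ < 1) (hφ0 : 0 ≤ φ) (hκφ : κ ≤ Real.sin φ)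
    (h : ‖T.starProjection v‖ ≤ κ * ‖v‖) : lineAngle Tᗮ v ≤ φ := by
  rw [lineAngle, angle_comm]
  refine angle_le_of_norm_sub_le hv hκ hκ1 hφ0 hκφ ?_
  rwa [Submodule.starProjection_orthogonal_val, sub_sub_cancel_left, norm_neg]

/-- Linear substitute for `arcsin`, turning small relative errors into angles. -/
lemma le_sin_of_le {x : ℝ} (h0 : 0 < x) (h1 : x ≤ 1 / 4) : x ≤ Real.sin (11 / 10 * x) := by
  have := Real.sin_gt_sub_cube (x := 11 / 10 * x) (by linarith)
  nlinarith [mul_pos h0 h0, mul_pos (mul_pos h0 h0) h0]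

/-! ### Critical points -/

lemma sub_mem_normalSpace {X : Set (E k)} {m y : E k} (hy : y ∈ closestPoints X m) :
    m - y ∈ normalSpace X y := by
  apply mem_normalSpace_of_forall
  rintro v ⟨γ, hγ0, hγX, hγd⟩
  have hmin : IsLocalMin (fun t => ‖γ t - m‖ ^ 2) 0 := by
    filter_upwards [hγX] with t ht
    rw [hγ0, ← dist_eq_norm, ← dist_eq_norm, dist_comm y, dist_comm _ m, hy.2]
    have := Metric.infDist_le_dist_of_mem (x := m) ht
    have h0 := Metric.infDist_nonneg (x := m) (s := X)
    gcongr
  have hd : HasDerivAt (fun t => ‖γ t - m‖ ^ 2) (2 * ⟪γ 0 - m, v⟫) 0 :=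
    (hγd.sub_const m).norm_sq
  have h := hmin.hasDerivAt_eq_zero hd
  rw [hγ0, ← neg_sub m y, inner_neg_left] at h
  linarith

lemma infDist_pos_of_notMem {X : Set (E k)} (hX : IsCompact X) (hne : X.Nonempty) {m : E k}
    (hm : m ∉ X) : 0 < Metric.infDist m X :=
  (hX.isClosed.notMem_iff_infDist_pos hne).mp hm

/-- At a critical point, no open half-space bounded by a hyperplane through it contains all the
closest points. -/
lemma exists_inner_nonpos_of_mem_criticalPoints {X : Set (E k)} (hX : IsCompact X)
    (hne : X.Nonempty) {m : E k} (hm : m ∈ criticalPoints X) {y : E k}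
    (hy : y ∈ closestPoints X m) : ∃ z ∈ closestPoints X m, ⟪y - m, z - m⟫ ≤ 0 := by
  obtain ⟨hmX, c, r, hmeb, hc⟩ := hm
  have hR := infDist_pos_of_notMem hX hne hmX
  set R := Metric.infDist m X with hRdef
  have hcm : c = m := by
    have := (smul_eq_zero.mp hc.symm).resolve_left (inv_ne_zero hR.ne')
    exact (sub_eq_zero.mp this).symm
  subst hcm
  by_contra! hcon
  have hnorm : ∀ z ∈ closestPoints X c, ‖z - c‖ = R := fun z hz => by
    rw [← dist_eq_norm, dist_comm]; exact hz.2
  have hcomp : IsCompact (closestPoints X c) := by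
    have : closestPoints X c = X ∩ {z | dist c z = R} := rfl
    rw [this]
    exact hX.inter_right (isClosed_eq (by fun_prop) (by fun_prop))
  obtain ⟨z₀, hz₀, hmin⟩ := hcomp.exists_isMinOn ⟨y, hy⟩ (f := fun z => ⟪y - c, z - c⟫)
    (by fun_prop)
  set δ := ⟪y - c, z₀ - c⟫ with hδ
  have hδ0 : 0 < δ := hcon z₀ hz₀
  have hRr : R ≤ r := by
    have := hmeb.1 hy
    rw [Metric.mem_closedBall, dist_eq_norm, hnorm y hy] at this
    exact this
  -- If all inner products were at least `δ > 0`, moving the centre by `δ / R ^ 2` towards `y` would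
  -- give a smaller enclosing ball.
  have hsub : closestPoints X c ⊆
      Metric.closedBall (c + (δ / R ^ 2) • (y - c)) (Real.sqrt (R ^ 2 - δ ^ 2 / R ^ 2)) := by
    intro z hz
    rw [Metric.mem_closedBall, dist_eq_norm]
    apply Real.le_sqrt_of_sq_le
    have h1 : δ ≤ ⟪y - c, z - c⟫ := hmin hz
    rw [show z - (c + (δ / R ^ 2) • (y - c)) = (z - c) - (δ / R ^ 2) • (y - c) by abel,
      norm_sub_sq_real, norm_smul, real_inner_smul_right, hnorm z hz, hnorm y hy,
      Real.norm_of_nonneg (by positivity), real_inner_comm]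
    have h2 : δ / R ^ 2 * δ ≤ δ / R ^ 2 * ⟪y - c, z - c⟫ := by gcongr
    have h3 : (δ / R ^ 2 * R) ^ 2 = δ ^ 2 / R ^ 2 := by field_simp
    have h4 : δ / R ^ 2 * δ = δ ^ 2 / R ^ 2 := by ring
    linarith
  have hle := hmeb.2 _ _ hsub
  have h5 : Real.sqrt (R ^ 2 - δ ^ 2 / R ^ 2) < R := by
    rw [Real.sqrt_lt' hR]
    have : 0 < δ ^ 2 / R ^ 2 := by positivity
    linarith
  linarith

/-! ### Constants -/

lemma cBeta_pos {β : ℝ} (h0 : 0 < β) (h1 : β ≤ Real.pi / 4) : 0 < cBeta β := by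
  have := Real.tan_pos_of_pos_of_lt_pi_div_two (x := β / 2) (by linarith)
    (by linarith [Real.pi_pos])
  rw [cBeta]
  positivity

lemma cBeta_le {β : ℝ} (h0 : 0 < β) (h1 : β ≤ Real.pi / 4) : cBeta β ≤ 7 / 50 := by
  have hpi := Real.pi_pos
  have hmono := Real.strictMonoOn_tan.monotoneOn (a := β / 2) (b := Real.pi / 8)
    ⟨by linarith, by linarith⟩ ⟨by linarith, by linarith⟩ (by linarith)
  have hpos := Real.tan_pos_of_pos_of_lt_pi_div_two (x := Real.pi / 8) (by linarith) (by linarith)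
  have hlt1 := Real.strictMonoOn_tan (a := Real.pi / 8) (b := Real.pi / 4)
    ⟨by linarith, by linarith⟩ ⟨by linarith, by linarith⟩ (by linarith)
  rw [Real.tan_pi_div_four] at hlt1
  have h2 := Real.tan_two_mul (x := Real.pi / 8)
  rw [show 2 * (Real.pi / 8) = Real.pi / 4 by ring, Real.tan_pi_div_four, eq_div_iff
    (by nlinarith)] at h2
  -- By the double-angle formula the tangent is `√2 - 1`.
  have h3 : Real.tan (Real.pi / 8) ≤ 21 / 50 := by nlinarith
  rw [cBeta]
  linarith

/-- Replaces the possibly infinite `lfs` by its real lower bounds; `L = ⊤` is impossible, as the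
bounds `c * l` would be unbounded. -/
lemma ofReal_mul_le_of_forall {c d : ℝ} (hc : 0 < c) (hd : 0 ≤ d) {L : ℝ≥0∞}
    (h : ∀ l, 0 ≤ l → ENNReal.ofReal l ≤ L → c * l ≤ d) :
    ENNReal.ofReal c * L ≤ ENNReal.ofReal d := by
  rcases eq_or_ne L ⊤ with rfl | hL
  · have := h ((d + 1) / c) (by positivity) le_top
    rw [mul_div_cancel₀ _ hc.ne'] at this
    linarith
  · rw [← ENNReal.ofReal_toReal hL, ← ENNReal.ofReal_mul hc.le]
    exact ENNReal.ofReal_le_ofReal (h _ ENNReal.toReal_nonneg (ENNReal.ofReal_toReal hL).le)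

/-! ### The lower bound for the lean feature size -/

/-- A chord that makes an angle of at least `α` with the tangent space is long. -/
lemma IsSmoothSubmanifold.mul_sin_le_dist {s : ℕ} {X : Set (E k)}
    (hXs : IsSmoothSubmanifold s X) (hX : IsCompact X) {p q : E k} (hp : p ∈ X) (hq : q ∈ X)
    {l α : ℝ} (hl0 : 0 ≤ l) (hl : ENNReal.ofReal l ≤ lfs X p)
    (hα : -(Real.pi / 2) ≤ α)
    (hang : lineAngle (normalSpace X p) (q - p) ≤ Real.pi / 2 - α) (hne : q ≠ p) :
    2 * l * Real.sin α ≤ ‖q - p‖ := by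
  have h1 := hXs.norm_sub_starProjection_le hX hp hq hl0 hl
  rw [← Submodule.starProjection_orthogonal_val] at h1
  have h2 := norm_mul_cos_lineAngle (normalSpace X p) (q - p)
  have h2' : ‖(tangentSpan X p)ᗮ.starProjection (q - p)‖ =
      ‖q - p‖ * Real.cos (lineAngle (normalSpace X p) (q - p)) := h2.symm
  rw [h2'] at h1
  have hpos : 0 < ‖q - p‖ := norm_pos_iff.mpr (sub_ne_zero.mpr hne)
  have h3 := Real.cos_le_cos_of_nonneg_of_le_pi (angle_nonneg _ _) (by linarith) hang
  rw [Real.cos_pi_div_two_sub] at h3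
  have h4 : 2 * l * Real.cos (lineAngle (normalSpace X p) (q - p)) ≤ ‖q - p‖ := by
    refine le_of_mul_le_mul_right ?_ hpos
    linarith
  refine le_trans ?_ h4
  exact mul_le_mul_of_nonneg_left h3 (by positivity)

lemma IsSmoothSubmanifold.c₂_mul_lfs_le_lnfs {s : ℕ} {X : Set (E k)}
    (hXs : IsSmoothSubmanifold s X) (hX : IsCompact X) {P : Finset (E k)}
    (hPX : (P : Set (E k)) ⊆ X) {V : E k → Submodule ℝ (E k)} {β ν : ℝ} (hν : 0 ≤ ν)
    (hβ : 0 < β) (hβ4 : β ≤ Real.pi / 4) (hνβ : ν < β)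
    (hV : ∀ p ∈ P, subspaceAngle (V p) (normalSpace X p) ≤ ν) {p : E k} (hp : p ∈ P) :
    ENNReal.ofReal (c₂ β ν) * lfs X p ≤ lnfs β P V p := by
  have hpi := Real.pi_pos
  have hc0 : 0 < c₀ β ν := Real.sin_pos_of_pos_of_lt_pi (by linarith) (by linarith)
  have hcb := cBeta_pos hβ hβ4
  have hc2 : 0 < c₂ β ν := by rw [c₂]; positivity
  rw [lnfs, Metric.le_infEDist]
  rintro z ⟨a, b, hab, rfl⟩
  rw [edist_dist]
  refine ofReal_mul_le_of_forall hc2 dist_nonneg fun l hl0 hl => ?_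
  set z := midpoint ℝ a b with hz
  have haX : a ∈ X := hPX hab.left_mem
  have hbX : b ∈ X := hPX hab.right_mem
  set D := ‖b - a‖ with hD
  have hDab : dist a b = D := by rw [dist_comm, dist_eq_norm]
  have h1 : cBeta β * D ≤ dist p z := by
    have := hab.empty_ball p hp
    rw [Metric.mem_ball, not_lt, hDab] at this
    exact this
  have hang : lineAngle (normalSpace X a) (b - a) ≤ Real.pi / 2 - (β - ν) := by
    have h2 := lineAngle_le_add hν ((le_max_left _ _).trans (hV a hab.left_mem)) (b - a)
    have h3 := (le_max_left _ _).trans hab.angle_le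
    linarith
  have hpa : dist p a ≤ dist p z + D / 2 := by
    have h2 := dist_triangle p z a
    have h3 : dist z a = D / 2 := by
      rw [hz, dist_midpoint_left, hDab, Real.norm_of_nonneg (by norm_num)]; ring
    linarith
  have h4 : 2 * (l - dist p a) * c₀ β ν ≤ D := by
    rcases le_total 0 (l - dist p a) with h | h
    · exact hXs.mul_sin_le_dist hX haX hbX h (ofReal_sub_dist_le_lfs hl) (by linarith) hang hab.ne.symm
    · have h5 : 0 ≤ D := norm_nonneg _
      nlinarith
  have hden : 0 < 1 + c₀ β ν + 2 * c₀ β ν * cBeta β := by positivity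
  rw [c₂, div_mul_eq_mul_div, div_le_iff₀ hden]
  -- The length bound at `a` with `d(p, a) ≤ d(p, z) + D / 2`. Multiplying by `cBeta β` and using
  -- `cBeta β * D ≤ d(p, z)` eliminates `D` and yields `c₂`.
  have h6 : 2 * c₀ β ν * l ≤ 2 * c₀ β ν * dist p z + (1 + c₀ β ν) * D := by
    nlinarith
  have h7 : cBeta β * (2 * c₀ β ν * l)
      ≤ cBeta β * (2 * c₀ β ν * dist p z + (1 + c₀ β ν) * D) := by gcongr
  have h8 : (1 + c₀ β ν) * (cBeta β * D) ≤ (1 + c₀ β ν) * dist p z := by gcongr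
  linarith

/-- The numerator is nonpositive; the point is the denominator, at least `1 - 3/4 - 2 * (3/4) *
(7/50) = 1/25`. -/
lemma c₂_nonpos {β ν : ℝ} (hβ : 0 < β) (hβ4 : β ≤ Real.pi / 4) (hνβ : β ≤ ν)
    (hν4 : ν ≤ Real.pi / 4) : c₂ β ν ≤ 0 := by
  have hpi := Real.pi_pos
  have hcb := cBeta_pos hβ hβ4
  have hcb' := cBeta_le hβ hβ4
  have hc0 : c₀ β ν ≤ 0 :=
    Real.sin_nonpos_of_nonpos_of_neg_pi_le (by linarith) (by linarith)
  have hc0' : -(3 / 4) ≤ c₀ β ν := by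
    have h1 : Real.sin (-(Real.pi / 4)) ≤ c₀ β ν :=
      Real.sin_le_sin_of_le_of_le_pi_div_two (by linarith) (by linarith) (by linarith)
    rw [Real.sin_neg, Real.sin_pi_div_four] at h1
    have h2 : Real.sqrt 2 ≤ 3 / 2 := Real.sqrt_le_iff.mpr ⟨by norm_num, by norm_num⟩
    linarith
  rw [c₂]
  apply div_nonpos_of_nonpos_of_nonneg
  · nlinarith
  · nlinarith

/-! ### The upper bound for the lean feature size -/

/-- The sample has a point near each closest point of a point of the medial axis. -/
lemma IsDenseWrt.exists_near {X : Set (E k)} {P : Finset (E k)} {ε : ℝ} (hε : 0 < ε)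
    (hP : IsDenseWrt ε (lfs X) X P) {m y : E k} (hm : m ∈ medialAxis X)
    (hy : y ∈ closestPoints X m) :
    ∃ p ∈ P, ∃ l, 0 ≤ l ∧ l ≤ Metric.infDist m X ∧ ENNReal.ofReal l ≤ lfs X y ∧
      dist y p ≤ ε * l := by
  have h1 : lfs X y ≤ edist y m := Metric.infEDist_le_edist_of_mem hm
  have hfin : lfs X y ≠ ⊤ := ne_top_of_le_ne_top (edist_ne_top _ _) h1
  have hd := hP y hy.1
  have hdfin : ENNReal.ofReal ε * lfs X y ≠ ⊤ := ENNReal.mul_ne_top ENNReal.ofReal_ne_top hfin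
  have hne : (P : Set (E k)).Nonempty := by
    by_contra hcon
    rw [Set.not_nonempty_iff_eq_empty.mp hcon, Metric.infEDist_empty, top_le_iff] at hd
    exact hdfin hd
  obtain ⟨p, hp, hpe⟩ := P.finite_toSet.isCompact.exists_infEDist_eq_edist hne y
  refine ⟨p, hp, (lfs X y).toReal, ENNReal.toReal_nonneg, ?_, (ENNReal.ofReal_toReal hfin).le, ?_⟩
  · rw [← hy.2, dist_comm, dist_edist]
    exact ENNReal.toReal_mono (edist_ne_top _ _) h1
  · rw [hpe] at hd
    rw [dist_edist, ← ENNReal.toReal_ofReal hε.le, ← ENNReal.toReal_mul]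
    exact ENNReal.toReal_mono hdfin hd

/-- The direction from a closest point to its centre is almost normal at nearby points. -/
lemma IsSmoothSubmanifold.lineAngle_normalSpace_le {s : ℕ} {X : Set (E k)}
    (hXs : IsSmoothSubmanifold s X) (hX : IsCompact X) {m y p : E k}
    (hm : m ∉ X) (hy : y ∈ closestPoints X m) (hp : p ∈ X) {l ε : ℝ} (hl0 : 0 ≤ l)
    (hl : ENNReal.ofReal l ≤ lfs X y) (hε : 0 < ε) (hε1 : ε ≤ 1 / 16)
    (hyp : dist y p ≤ ε * l) :
    lineAngle (normalSpace X p) (m - y) ≤ 11 / 10 * (13 / 4 * ε) := by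
  have hmy : m - y ≠ 0 := by
    intro h
    rw [sub_eq_zero] at h
    exact hm (h ▸ hy.1)
  refine lineAngle_orthogonal_le hmy (by positivity) (by linarith) (by positivity)
    (le_sin_of_le (by positivity) (by linarith)) ?_
  have hn := sub_mem_normalSpace hy
  have hτ : (tangentSpan X p).starProjection (m - y) ∈ tangentSpan X p :=
    Submodule.starProjection_apply_mem _ _
  set τ := (tangentSpan X p).starProjection (m - y) with hτdef
  have hle : ⟪m - y, τ⟫ ≤ 13 / 4 * ε * ‖m - y‖ * ‖τ‖ := by
    rcases hl0.eq_or_lt with h0 | h0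
    · rw [← h0, mul_zero] at hyp
      have hyp' : y = p := dist_le_zero.mp hyp
      rw [← hyp'] at hτ
      rw [inner_eq_zero_of_mem_normalSpace hn hτ]
      positivity
    · exact hXs.inner_normal_tangent_le hX hy.1 hp h0 hl hε hε1 hyp hn hτ
  rw [hτdef, real_inner_starProjection_self, ← hτdef] at hle
  rcases (norm_nonneg τ).eq_or_lt with h0 | h0
  · rw [← h0]; positivity
  · refine le_of_mul_le_mul_right ?_ h0
    linarith

/-- The two summands are the tilt of the normal space between `y` and `p`, and the turn from `yz` to
`pq`. The bound uses `ε ≤ √ε / 4`. -/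
lemma mul_add_mul_le_sqrt {ε : ℝ} (hε : 0 < ε) (hε1 : ε ≤ 1 / 16) :
    11 / 10 * (13 / 4 * ε) + 11 / 10 * (283 / 200 * ε) ≤ 3 / 2 * Real.sqrt ε := by
  have h1 : Real.sqrt ε ≤ 1 / 4 := Real.sqrt_le_iff.mpr ⟨by norm_num, by linarith⟩
  nlinarith [Real.sq_sqrt hε.le, Real.sqrt_nonneg ε]

/-- Two points of a sphere whose directions from the centre form an angle of at least `π/2`. -/
lemma angle_sub_le_pi_div_four {u v : E k} {R : ℝ} (hR : 0 < R) (hu : ‖u‖ = R) (hv : ‖v‖ = R)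
    (huv : ⟪u, v⟫ ≤ 0) : angle (v - u) (-u) ≤ Real.pi / 4 := by
  have h1 : ⟪v - u, -u⟫ = R ^ 2 - ⟪u, v⟫ := by
    rw [inner_neg_right, inner_sub_left, real_inner_self_eq_norm_sq, hu, real_inner_comm]; ring
  have h2 : ‖v - u‖ ^ 2 = 2 * (R ^ 2 - ⟪u, v⟫) := by
    rw [norm_sub_sq_real, hu, hv, real_inner_comm]; ring
  have hR2 : 0 < R ^ 2 := by positivity
  have hne : v - u ≠ 0 := by
    intro h; rw [h, norm_zero] at h2; nlinarith
  have hun : -u ≠ 0 := by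
    rw [neg_ne_zero, ← norm_pos_iff, hu]; exact hR
  refine angle_le_of_sq_le hne hun (κ := Real.sqrt 2 / 2) (by positivity)
    (by positivity) Real.sin_pi_div_four.ge (by rw [h1]; linarith) ?_
  rw [h1, h2, norm_neg, hu, div_pow, Real.sq_sqrt (by norm_num)]
  nlinarith

/-- Chain of angles from `q - p` to `z - y`, to `m - y`, to its projection on the normal space at
`p`, and finally to `U`. -/
lemma IsSmoothSubmanifold.lineAngle_chord_le {s : ℕ} {X : Set (E k)}
    (hXs : IsSmoothSubmanifold s X) (hX : IsCompact X) {m y z p q : E k} (hm : m ∉ X)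
    (hy : y ∈ closestPoints X m) (hz : z ∈ closestPoints X m) (hyz : ⟪y - m, z - m⟫ ≤ 0)
    (hp : p ∈ X) {l ε ν : ℝ} (hl0 : 0 ≤ l)
    (hl : ENNReal.ofReal l ≤ lfs X y) (hlm : l ≤ Metric.infDist m X)
    (hε : 0 < ε) (hε1 : ε ≤ 1 / 16) (hyp : dist y p ≤ ε * l)
    (hzq : dist z q ≤ ε * Metric.infDist m X) {U : Submodule ℝ (E k)} (hν : 0 ≤ ν)
    (hU : subspaceAngle U (normalSpace X p) ≤ ν) :
    lineAngle U (q - p) ≤ Real.pi / 4 + 3 / 2 * Real.sqrt ε + ν := by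
  have hR := infDist_pos_of_notMem hX ⟨p, hp⟩ hm
  set R := Metric.infDist m X with hRdef
  have hym : ‖y - m‖ = R := by rw [← dist_eq_norm, dist_comm]; exact hy.2
  have hzm : ‖z - m‖ = R := by rw [← dist_eq_norm, dist_comm]; exact hz.2
  have hyp' : dist y p ≤ ε * R := hyp.trans (by gcongr)
  have a1 := lineAngle_le_add hν ((le_max_right _ _).trans hU) (q - p)
  have a2 := lineAngle_le_angle
    (Submodule.starProjection_apply_mem (normalSpace X p) (m - y)) (q - p)
  have a3 := angle_le_angle_add_angle (q - p) (z - y)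
    ((normalSpace X p).starProjection (m - y))
  have a4 := angle_le_angle_add_angle (z - y) (m - y)
    ((normalSpace X p).starProjection (m - y))
  have a5 := hXs.lineAngle_normalSpace_le hX hm hy hp hl0 hl hε hε1 hyp
  rw [lineAngle] at a5
  have a6 := angle_sub_le_pi_div_four hR hym hzm hyz
  rw [sub_sub_sub_cancel_right, neg_sub] at a6
  have hzy : ‖z - y‖ ^ 2 = 2 * R ^ 2 - 2 * ⟪y - m, z - m⟫ := by
    rw [← sub_sub_sub_cancel_right z y m, norm_sub_sq_real, hzm, hym, real_inner_comm]; ring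
  have hzy' : 707 / 500 * R ≤ ‖z - y‖ := by
    refine (pow_le_pow_iff_left₀ (by positivity) (norm_nonneg _) two_ne_zero).mp ?_
    nlinarith
  have hne : z - y ≠ 0 := by
    rw [← norm_pos_iff]
    exact lt_of_lt_of_le (by positivity) hzy'
  -- The endpoints move by at most `2 * ε * R` in total, while `‖z - y‖ ≥ √2 * R`: relative error
  -- `√2 * ε`. The decimals `707/500` and `283/200` bracket `√2`.
  have a7 : angle (q - p) (z - y) ≤ 11 / 10 * (283 / 200 * ε) := by
    refine angle_le_of_norm_sub_le hne (by positivity) (by linarith) (by positivity)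
      (le_sin_of_le (by positivity) (by linarith)) ?_
    have h1 : ‖(q - p) - (z - y)‖ ≤ ‖y - p‖ + ‖z - q‖ := by
      rw [show (q - p) - (z - y) = (y - p) - (z - q) by abel]; exact norm_sub_le _ _
    rw [← dist_eq_norm y p, ← dist_eq_norm z q] at h1
    have h2 : 283 / 200 * ε * (707 / 500 * R) ≤ 283 / 200 * ε * ‖z - y‖ := by gcongr
    nlinarith [mul_pos hε hR]
  have a8 := mul_add_mul_le_sqrt hε hε1
  linarith

/-- Near every critical point there is a point of the lean set. -/
lemma IsSmoothSubmanifold.exists_mem_leanSet {s : ℕ} {X : Set (E k)}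
    (hXs : IsSmoothSubmanifold s X) (hX : IsCompact X) (hne : X.Nonempty) {P : Finset (E k)}
    (hPX : (P : Set (E k)) ⊆ X) {V : E k → Submodule ℝ (E k)} {ε ν β : ℝ} (hε : 0 < ε)
    (hε1 : ε ≤ 1 / 16) (hν : 0 ≤ ν) (hβ : 0 < β) (hP : IsDenseWrt ε (lfs X) X P)
    (hV : ∀ p ∈ P, subspaceAngle (V p) (normalSpace X p) ≤ ν)
    (hβν : β + 3 / 2 * Real.sqrt ε + ν ≤ Real.pi / 4) {m : E k} (hm : m ∈ criticalPoints X) :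
    ∃ z ∈ leanSet β P V, dist m z ≤ (Real.sqrt 2 / 2 + ε) * Metric.infDist m X := by
  have hmX : m ∉ X := hm.1
  have hR := infDist_pos_of_notMem hX hne hmX
  set R := Metric.infDist m X with hRdef
  obtain ⟨y, hy⟩ := closestPoints_nonempty hX hne m
  obtain ⟨z, hz, hyz⟩ := exists_inner_nonpos_of_mem_criticalPoints hX hne hm hy
  have hym : ‖y - m‖ = R := by rw [← dist_eq_norm, dist_comm]; exact hy.2
  have hzm : ‖z - m‖ = R := by rw [← dist_eq_norm, dist_comm]; exact hz.2
  have hyzne : y ≠ z := by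
    rintro rfl
    rw [real_inner_self_eq_norm_sq, hym] at hyz
    nlinarith
  have hmM : m ∈ medialAxis X := subset_closure ⟨y, hy, z, hz, hyzne⟩
  obtain ⟨p, hp, l, hl0, hlR, hl, hyp⟩ := hP.exists_near hε hmM hy
  obtain ⟨q, hq, l', hl0', hlR', hl', hzq⟩ := hP.exists_near hε hmM hz
  have hyp' : ‖p - y‖ ≤ ε * R := by
    rw [← dist_eq_norm, dist_comm]; exact hyp.trans (by gcongr)
  have hzq' : ‖q - z‖ ≤ ε * R := by
    rw [← dist_eq_norm, dist_comm]; exact hzq.trans (by gcongr)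
  have ang1 := hXs.lineAngle_chord_le hX hmX hy hz hyz (hPX hp) hl0 hl hlR hε hε1 hyp
    (hzq.trans (by gcongr)) hν (hV p hp)
  have ang2 := hXs.lineAngle_chord_le hX hmX hz hy (by rwa [real_inner_comm]) (hPX hq) hl0' hl'
    hlR' hε hε1 hzq (hyp.trans (by gcongr)) hν (hV q hq)
  rw [← neg_sub, lineAngle_neg] at ang2
  have hR2 : 0 < R ^ 2 := by positivity
  -- `g` is minus the cosine of the angle at `m`. The chord and twice the distance from `m` to its
  -- midpoint are `√(2(1 ± g)) R`, bounded linearly in `g` below.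
  set g := -⟪y - m, z - m⟫ / R ^ 2 with hg
  have hgR : ⟪y - m, z - m⟫ = -(g * R ^ 2) := by rw [hg]; field_simp
  have hg0 : 0 ≤ g := div_nonneg (by linarith) hR2.le
  have hg1 : g ≤ 1 := by
    rw [hg, div_le_one hR2]
    have h1 := real_inner_le_norm (-(y - m)) (z - m)
    rw [inner_neg_left, norm_neg, hym, hzm] at h1
    linarith
  have hyz2 : ‖z - y‖ ^ 2 = 2 * (1 + g) * R ^ 2 := by
    rw [← sub_sub_sub_cancel_right z y m, norm_sub_sq_real, hzm, hym, real_inner_comm, hgR]; ring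
  have hyzle : ‖z - y‖ ≤ 283 / 200 * (1 + g / 2) * R := by
    refine (pow_le_pow_iff_left₀ (norm_nonneg _) (by positivity) two_ne_zero).mp ?_
    rw [hyz2, mul_pow]
    refine mul_le_mul_of_nonneg_right ?_ hR2.le
    nlinarith
  have hyzge : 7 / 5 * R ≤ ‖z - y‖ := by
    refine (pow_le_pow_iff_left₀ (by positivity) (norm_nonneg _) two_ne_zero).mp ?_
    rw [hyz2]
    nlinarith
  have hmid2 : ‖(y - m) + (z - m)‖ ^ 2 = 2 * (1 - g) * R ^ 2 := by
    rw [norm_add_sq_real, hym, hzm, hgR]; ring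
  have hmid : dist m (midpoint ℝ p q) ≤ ‖(y - m) + (z - m)‖ / 2 + ε * R := by
    have h1 : midpoint ℝ p q - m
        = (1 / 2 : ℝ) • (((y - m) + (z - m)) + ((p - y) + (q - z))) := by
      rw [midpoint_eq_smul_add]
      simp only [invOf_eq_inv]
      module
    rw [dist_comm, dist_eq_norm, h1, norm_smul, Real.norm_of_nonneg (by norm_num)]
    have h2 := norm_add_le ((y - m) + (z - m)) ((p - y) + (q - z))
    have h3 := norm_add_le (p - y) (q - z)
    linarith
  have hpq : dist p q ≤ ‖z - y‖ + 2 * (ε * R) := by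
    rw [dist_comm, dist_eq_norm, show q - p = (z - y) + ((q - z) - (p - y)) by abel]
    have h2 := norm_add_le (z - y) ((q - z) - (p - y))
    have h3 := norm_sub_le (q - z) (p - y)
    linarith
  have hεR : ε * R ≤ 1 / 16 * R := by gcongr
  have hpqne : p ≠ q := by
    rintro rfl
    have h1 : ‖z - y‖ ≤ ‖p - y‖ + ‖p - z‖ := by
      rw [show z - y = (p - y) - (p - z) by abel]; exact norm_sub_le _ _
    linarith
  have hs := Real.sqrt_nonneg ε
  have hcb := cBeta_pos hβ (by linarith)
  have hcb' := cBeta_le hβ (by linarith)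
  refine ⟨midpoint ℝ p q, ⟨p, q, ⟨hp, hq, hpqne, ?_, ?_⟩, rfl⟩, ?_⟩
  · exact max_le (by linarith) (by linarith)
  · intro x hx
    rw [Metric.mem_ball, not_lt]
    have h1 : R ≤ dist m x := Metric.infDist_le_dist_of_mem (hPX hx)
    have h2 := dist_triangle m (midpoint ℝ p q) x
    rw [dist_comm (midpoint ℝ p q) x] at h2
    have h3 : ‖(y - m) + (z - m)‖ ≤ 283 / 200 * (1 - g / 2) * R := by
      refine (pow_le_pow_iff_left₀ (norm_nonneg _)
        (mul_nonneg (mul_nonneg (by norm_num) (by linarith)) hR.le) two_ne_zero).mp ?_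
      rw [hmid2, mul_pow]
      refine mul_le_mul_of_nonneg_right ?_ hR2.le
      nlinarith
    -- The tight case is the right angle `g = 0`: the ball radius is below `0.216 R`, and the
    -- midpoint is at least `0.23 R` from every sample point.
    have h4 : cBeta β * dist p q ≤ 7 / 50 * (283 / 200 * (1 + g / 2) * R + 2 * (1 / 16 * R)) := by
      refine mul_le_mul hcb' (by linarith) dist_nonneg (by norm_num)
    have h5 : 0 ≤ g * R := by positivity
    linarith
  · have h3 : ‖(y - m) + (z - m)‖ ≤ Real.sqrt 2 * R := by
      refine (pow_le_pow_iff_left₀ (norm_nonneg _) (by positivity) two_ne_zero).mp ?_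
      rw [hmid2, mul_pow, Real.sq_sqrt (by norm_num)]
      refine mul_le_mul_of_nonneg_right ?_ hR2.le
      linarith
    linarith

end LeanFeature

theorem theorem1 (k s : ℕ) (X : Set (LeanFeature.E k)) (hX : IsCompact X)
    (hXs : LeanFeature.IsSmoothSubmanifold s X)
    (P : Finset (LeanFeature.E k)) (hPX : (P : Set (LeanFeature.E k)) ⊆ X)
    (V : LeanFeature.E k → Submodule ℝ (LeanFeature.E k))
    (ε ν θ β : ℝ) (hε : 0 < ε) (hν : 0 ≤ ν) (hθ : 0 < θ) (hβ : 0 < β)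
    (hP : LeanFeature.IsDenseWrt ε (LeanFeature.lfs X) X P)
    (hV : ∀ p ∈ P, LeanFeature.subspaceAngle (V p) (LeanFeature.normalSpace X p) ≤ ν)
    (hθ4 : θ ≤ Real.pi / 4) (hβθ : β + 3 / 2 * Real.sqrt ε + ν ≤ θ)
    (hεθ : ε ≤ 1 / 8 * Real.sin θ ^ 2) :
    (∀ x ∈ X, LeanFeature.lnfs β P V x
        ≤ ENNReal.ofReal (LeanFeature.c₁ θ ε) * LeanFeature.lwfs X x) ∧
    (∀ p ∈ P, ENNReal.ofReal (LeanFeature.c₂ β ν) * LeanFeature.lfs X p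
        ≤ LeanFeature.lnfs β P V p) ∧
    0 < LeanFeature.c₁ θ ε ∧ 0 < LeanFeature.cBeta β ∧
    (ν < β → 0 < LeanFeature.c₀ β ν ∧ 0 < LeanFeature.c₂ β ν) := by
  have hpi := Real.pi_pos
  have hs := Real.sqrt_nonneg ε
  have hsin : Real.sin θ ^ 2 ≤ 1 / 2 := by
    have h0 : 0 ≤ Real.sin θ := Real.sin_nonneg_of_nonneg_of_le_pi hθ.le (by linarith)
    have h1 := Real.sin_le_sin_of_le_of_le_pi_div_two (by linarith) (by linarith) hθ4
    rw [Real.sin_pi_div_four] at h1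
    calc Real.sin θ ^ 2 ≤ (Real.sqrt 2 / 2) ^ 2 := by gcongr
      _ = 1 / 2 := by rw [div_pow, Real.sq_sqrt (by norm_num)]; norm_num
  have hε1 : ε ≤ 1 / 16 := by linarith
  have hβ4 : β ≤ Real.pi / 4 := by linarith
  have hν4 : ν ≤ Real.pi / 4 := by linarith
  have hcos : Real.sqrt 2 / 2 ≤ Real.cos θ := by
    rw [← Real.cos_pi_div_four]
    exact Real.cos_le_cos_of_nonneg_of_le_pi hθ.le (by linarith) hθ4
  have hcos0 : 0 ≤ Real.cos θ := le_trans (by positivity) hcos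
  have hc1 : 0 < LeanFeature.c₁ θ ε := by
    rw [LeanFeature.c₁]; positivity
  have hcb := LeanFeature.cBeta_pos hβ hβ4
  refine ⟨fun x hx => ?_, fun p hp => ?_, hc1, hcb, fun hνβ => ?_⟩
  -- Dividing by `c₁` reduces the bound to one inequality per critical point; without critical
  -- points `lwfs` is infinite.
  · rw [← ENNReal.div_le_iff' (by simpa using hc1) ENNReal.ofReal_ne_top, LeanFeature.lwfs,
      Metric.le_infEDist]
    intro m hm
    rw [ENNReal.div_le_iff' (by simpa using hc1) ENNReal.ofReal_ne_top]
    obtain ⟨z, hz, hmz⟩ := hXs.exists_mem_leanSet hX ⟨x, hx⟩ hPX hε hε1 hν hβ hP hV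
      (hβθ.trans hθ4) hm
    refine (Metric.infEDist_le_edist_of_mem hz).trans ?_
    rw [edist_dist, edist_dist, ← ENNReal.ofReal_mul hc1.le]
    apply ENNReal.ofReal_le_ofReal
    have h1 : Metric.infDist m X ≤ dist x m := by
      rw [dist_comm]; exact Metric.infDist_le_dist_of_mem hx
    -- `θ ≤ π/4` gives `√2/2 ≤ cos θ`, so the distance found from `m` to the lean set fits into
    -- `c₁`.
    have h2 : (Real.sqrt 2 / 2 + ε) * Metric.infDist m X ≤ (Real.cos θ + ε) * dist x m :=
      mul_le_mul (by linarith) h1 Metric.infDist_nonneg (by linarith)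
    rw [LeanFeature.c₁]
    linarith [dist_triangle x m z]
  · rcases lt_or_ge ν β with hνβ | hνβ
    · exact hXs.c₂_mul_lfs_le_lnfs hX hPX hν hβ hβ4 hνβ hV hp
    · rw [ENNReal.ofReal_of_nonpos (LeanFeature.c₂_nonpos hβ hβ4 hνβ hν4), zero_mul]
      exact zero_le
  · have hc0 : 0 < LeanFeature.c₀ β ν :=
      Real.sin_pos_of_pos_of_lt_pi (by linarith) (by linarith)
    refine ⟨hc0, ?_⟩
    rw [LeanFeature.c₂]
    positivity
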